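/- **Setting.** Let $\mathfrak g$ be the Lie algebra of a compact Lie group, i.e. a finite-dimensional real Lie algebra with an inner product satisfying $\langle[\xi,\eta],\zeta\rangle+\langle\eta,[\xi,\zeta]\rangle=0$. Let $n\ge 2$, let $\Omega\subset\mathbb R^n$ be a bounded Lipschitz domain, and let $\mathcal T_h$ be a triangulation of $\overline\Omega$ (a finite simplicial complex with underlying space $\overline\Omega$; its elements $K$ are the closed $n$-simplices). For $\mathfrak g$-valued forms, $[u\wedge v]$ and $\langle u\wedge v\rangle$ denote the wedge products in which the coefficients are multiplied by the bracket and by the inner product, $d_Au=du+[A\wedge u]$ and $F_A=dA+\frac12[A\wedge A]$. Exterior derivatives are weak (distributional). Put $$V^0=\{\phi\in L^\infty\Lambda^0(\Omega,\mathfrak g):d\phi\in L^4\},\quad V^1=\{A\in L^4\Lambda^1(\Omega,\mathfrak g):dA\in L^2\},$$ $$\widehat V^{n-1}=\{\widehat D\in L^{4/3}\Lambda^{n-1}(\Omega,\mathfrak g):d\widehat D\in L^1\},\quad \widehat V^{n-2}=\{\widehat H\in L^2\Lambda^{n-2}(\Omega,\mathfrak g):d\widehat H\in L^{4/3}\},$$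 and let $DV^0$, $DV^1$ be defined like $V^0$, $V^1$, but with $d\phi$, $dA$ computed on the interior of each element $K$ separately; these spaces carry their graph norms. For a $k$-form $u$ and an $(n-k-1)$-form $v$ of this regularity on a set $U$ ($U=\Omega$ or $U=K$) put $$\int_{\partial U}\langle u\wedge v\rangle:=\int_U\bigl(\langle du\wedge v\rangle+(-1)^k\langle u\wedge dv\rangle\bigr).$$ Tangential traces are understood through this pairing. Thus $\mathring V^0$ (resp. $\mathring V^1$) consists of the $u\in V^0$ (resp. $V^1$) with $\int_{\partial\Omega}\langle u\wedge v\rangle=0$ for all $v\in\widehat V^{n-1}$ (resp. $\widehat V^{n-2}$). An $(n-2)$-form in $L^2(K)$ with exterior derivative in $L^{4/3}(K)$ has as tangential trace on $\partial K$ the functional $A'\mapsto\int_{\partial K}\langle A'\wedge\cdot\rangle$ on $DV^1$, and an $(n-1)$-form in $L^{4/3}(K)$ with exterior derivative in $L^1(K)$ has the functional $\phi'\mapsto\int_{\partial K}\langle\phi',\cdot\rangle$ on $DV^0$. Let $\epsilon_x:\bigwedge^1\to\bigwedge^{n-1}$ and $\mu_x^{-1}:\bigwedge^2\to\bigwedge^{n-2}$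 ($x\in\overline\Omega$) be symmetric isomorphisms ($\alpha\wedge\epsilon\beta=\beta\wedge\epsilon\alpha$, $\alpha\wedge\mu^{-1}\beta=\beta\wedge\mu^{-1}\alpha$), depending on $x$ in an $L^\infty$ way and extended to $\mathfrak g$-valued forms by acting trivially on coefficients. Let $I\subset\mathbb R$ be a nondegenerate interval, $A$ a $C^1$ curve $I\to DV^1$, $\phi$ a $C^0$ curve $I\to DV^0$, and $\rho$ a $C^1$ curve $I\to L^1\Lambda^n(\Omega,\mathfrak g)$. With space derivatives computed elementwise, put $E=-(\dot A+d_A\phi)$, $B=F_A$, $D=\epsilon E$, $H=\mu^{-1}B$, and assume that $D$ is a $C^1$ curve in $L^4\Lambda^{n-1}(\Omega,\mathfrak g)$. $(A,\phi)$ *solves the weak Yang–Mills equations* if $A$ is a $C^1$ curve in $\mathring V^1$, $\phi$ is a $C^0$ curve in $\mathring V^0$, and for all $t\in I$ $$\int_{\Omega}\bigl(\langle A'\wedge(\dot D-[\phi,D])\rangle-\langle d_AA'\wedge H\rangle\bigr)=0\quad\forall A'\in\mathring V^1,\qquad \int_{\Omega}\bigl(\langle d_A\phi'\wedge D\rangle+\langle\phi',\rho\rangle\bigr)=0\quad\forall\phi'\in\mathring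 V^0 .$$ For $\widehat H(t)\in\widehat V^{n-2}$ and $\widehat D(t)\in\widehat V^{n-1}$ ($t\in I$), $(A,\phi,\widehat H,\widehat D)$ *solves the domain-decomposed equations* if for all $t\in I$ and all $K\in\mathcal T_h$ $$\int_K\bigl(\langle A'\wedge(\dot D-[\phi,D])\rangle-\langle d_AA'\wedge H\rangle\bigr)+\int_{\partial K}\langle A'\wedge\widehat H\rangle=0\quad\forall A'\in DV^1,$$ $$\int_K\bigl(\langle d_A\phi'\wedge D\rangle+\langle\phi',\rho\rangle\bigr)-\int_{\partial K}\langle\phi',\widehat D\rangle=0\quad\forall\phi'\in DV^0,$$ $$\sum_{K}\int_{\partial K}\langle A\wedge\widehat H'\rangle=0\quad\forall\widehat H'\in\widehat V^{n-2},\qquad \sum_{K}\int_{\partial K}\langle\phi,\widehat D'\rangle=0\quad\forall\widehat D'\in\widehat V^{n-1}.$$ **Proposition.** (i) For all $\widehat H:I\to\widehat V^{n-2}$ and $\widehat D:I\to\widehat V^{n-1}$, the tuple $(A,\phi,\widehat H,\widehat D)$ solves the domain-decomposed equations if and only if $(A,\phi)$ solves the weak Yang–Mills equations and, at every $t\in I$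 and on every element $K$, the tangential traces of $H$ and $D$ on $\partial K$ exist and $\widehat H|_{\partial K}=H|_{\partial K}$, $\widehat D|_{\partial K}=D|_{\partial K}$. (ii) If $(A,\phi)$ solves the weak Yang–Mills equations, then there are $\widehat H$, $\widehat D$ such that $(A,\phi,\widehat H,\widehat D)$ solves the domain-decomposed equations. -/

import Mathlib

open MeasureTheory Set
open scoped ENNReal NNReal ContDiff Topology TensorProduct

noncomputable section

namespace YM

/-! ### The Lie algebra -/

/-- A normed group and a Lie ring with the same addition. -/
class NormedLieRing (g : Type*) extends NormedAddCommGroup g, LieRing g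

/-- A real Lie algebra with an invariant inner product.  With `[FiniteDimensional ℝ g]` these are
exactly the Lie algebras of compact Lie groups, with the choice of an invariant inner product. -/
class InvariantLieAlgebra (g : Type*) [NormedLieRing g] extends
    InnerProductSpace ℝ g, LieAlgebra ℝ g where
  invariant : ∀ ξ η ζ : g, Inner.inner ℝ ⁅ξ, η⁆ ζ + Inner.inner ℝ η ⁅ξ, ζ⁆ = 0

/-- The Lie bracket as a continuous bilinear map. -/
def bracketL (g : Type*) [NormedLieRing g] [InvariantLieAlgebra g] [FiniteDimensional ℝ g] :
    g →L[ℝ] g →L[ℝ] g :=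
  LinearMap.toContinuousLinearMap
    ((LinearMap.toContinuousLinearMap : (g →ₗ[ℝ] g) ≃ₗ[ℝ] (g →L[ℝ] g)).toLinearMap ∘ₗ
      (LieModule.toEnd ℝ g g : g →ₗ[ℝ] (g →ₗ[ℝ] g)))

/-! ### Exterior algebra -/

/-- `ℝⁿ` with its Euclidean structure. -/
abbrev Space (n : ℕ) : Type := EuclideanSpace ℝ (Fin n)

/-- `F`-valued alternating `k`-forms on `ℝⁿ`, that is `⋀ᵏ(ℝⁿ)* ⊗ F`. -/
abbrev Form (n k : ℕ) (F : Type*) [NormedAddCommGroup F] [NormedSpace ℝ F] : Type _ :=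
  Space n [⋀^Fin k]→L[ℝ] F

section Wedge

variable {F₁ F₂ F₃ : Type*} [NormedAddCommGroup F₁] [NormedSpace ℝ F₁]
  [NormedAddCommGroup F₂] [NormedSpace ℝ F₂] [NormedAddCommGroup F₃] [NormedSpace ℝ F₃]

/-- The exterior product of vector-valued forms, where the coefficients are multiplied by a bilinear
map `β`: `(a ⊗ ξ) ∧ (b ⊗ η) = (a ∧ b) ⊗ β ξ η`, a sum over `(k, l)`-shuffles.  The degree `j` of the
product is only required to be propositionally equal to `k + l`. -/
def wedge {n k l j : ℕ} (β : F₁ →L[ℝ] F₂ →L[ℝ] F₃) (h : k + l = j)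
    (u : Form n k F₁) (v : Form n l F₂) : Form n j F₃ :=
  { ((TensorProduct.lift β.toLinearMap₁₂).compAlternatingMap
      (u.toAlternatingMap.domCoprod v.toAlternatingMap)).domDomCongr
        (finSumFinEquiv.trans (finCongr h)) with
    cont := by
      have key : ∀ σ : Equiv.Perm.ModSumCongr (Fin k) (Fin l), Continuous fun w : Fin j → Space n =>
          TensorProduct.lift β.toLinearMap₁₂
            (AlternatingMap.domCoprod.summand u.toAlternatingMap v.toAlternatingMap σ
              (fun i => w ((finSumFinEquiv.trans (finCongr h)) i))) := by
        intro σ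
        induction σ using Quotient.inductionOn' with | _ σ
        have h1 : Continuous fun w : Fin j → Space n =>
            u (fun i => w ((finSumFinEquiv.trans (finCongr h)) (σ (Sum.inl i)))) := by fun_prop
        have h2 : Continuous fun w : Fin j → Space n =>
            v (fun i => w ((finSumFinEquiv.trans (finCongr h)) (σ (Sum.inr i)))) := by fun_prop
        have h3 : Continuous fun w : Fin j → Space n => ((Equiv.Perm.sign σ : ℤˣ) : ℤ) •
            β (u (fun i => w ((finSumFinEquiv.trans (finCongr h)) (σ (Sum.inl i)))))
              (v (fun i => w ((finSumFinEquiv.trans (finCongr h)) (σ (Sum.inr i))))) :=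
          ((β.continuous.comp h1).clm_apply h2).fun_const_smul _
        convert! h3 using 2 with w
        exact map_zsmul (TensorProduct.lift β.toLinearMap₁₂) ((Equiv.Perm.sign σ : ℤˣ) : ℤ)
          ((u fun i => w ((finSumFinEquiv.trans (finCongr h)) (σ (Sum.inl i)))) ⊗ₜ[ℝ]
            (v fun i => w ((finSumFinEquiv.trans (finCongr h)) (σ (Sum.inr i)))))
      have hs := continuous_finsetSum (Finset.univ (α := Equiv.Perm.ModSumCongr (Fin k) (Fin l)))
        (fun σ _ => key σ)
      convert hs using 2 with w
      change TensorProduct.lift β.toLinearMap₁₂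
        (AlternatingMap.domCoprod u.toAlternatingMap v.toAlternatingMap _) = _
      rw [AlternatingMap.domCoprod_apply, sum_apply, map_sum]
      rfl }

/-- The coefficient of an `n`-form on `ℝⁿ` with respect to `dx₁ ∧ ⋯ ∧ dxₙ`; the integral of an
`n`-form is the Lebesgue integral of this coefficient. -/
def coeff {n : ℕ} (α : Form n n ℝ) : ℝ := α fun i => EuclideanSpace.single i 1

end Wedge

/-- `[u ∧ v]`. -/
def brk {g : Type*} [NormedLieRing g] [InvariantLieAlgebra g] [FiniteDimensional ℝ g]
    {n k l j : ℕ} (h : k + l = j) (u : Form n k g) (v : Form n l g) : Form n j g :=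
  wedge (bracketL g) h u v

/-- The coefficient of the `n`-form `⟨u ∧ v⟩` for forms of complementary degrees. -/
def pair {g : Type*} [NormedAddCommGroup g] [InnerProductSpace ℝ g]
    {n k l : ℕ} (h : k + l = n) (u : Form n k g) (v : Form n l g) : ℝ :=
  coeff (wedge (innerSL ℝ) h u v)

/-- The extension `T ⊗ id` to `g`-valued forms of a map between spaces of real-valued forms. -/
def extendCoeff {g : Type*} [NormedAddCommGroup g] [InnerProductSpace ℝ g] [FiniteDimensional ℝ g]
    {n k l : ℕ} (T : Form n k ℝ →L[ℝ] Form n l ℝ) (u : Form n k g) : Form n l g :=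
  ∑ i, (ContinuousLinearMap.toSpanSingleton ℝ
      (stdOrthonormalBasis ℝ g i)).compContinuousAlternatingMap
    (T ((innerSL ℝ (stdOrthonormalBasis ℝ g i)).compContinuousAlternatingMap u))

/-! ### Domains and triangulations -/

/-- Lipschitz domains: connected open sets that near every boundary point are the strict epigraph of
a Lipschitz function over a hyperplane. -/
structure IsLipschitzDomain {n : ℕ} (Ω : Set (Space n)) : Prop where
  isOpen : IsOpen Ω
  isConnected : IsConnected Ω
  boundary : ∀ x ∈ frontier Ω, ∃ ν : Space n, ‖ν‖ = 1 ∧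
    ∃ (γ : (ℝ ∙ ν)ᗮ → ℝ) (C : ℝ≥0), LipschitzWith C γ ∧
      ∀ᶠ y in 𝓝 x, (y ∈ Ω ↔ γ ((ℝ ∙ ν)ᗮ.orthogonalProjectionOnto y) < inner ℝ ν y)

/-- A finite simplicial complex triangulates `closure Ω`. -/
structure IsTriangulation {n : ℕ} (T : Geometry.SimplicialComplex ℝ (Space n))
    (Ω : Set (Space n)) : Prop where
  finite : T.faces.Finite
  space_eq : T.space = closure Ω

/-- The elements of a triangulation: its (closed) `n`-simplices. -/
def elements {n : ℕ} (T : Geometry.SimplicialComplex ℝ (Space n)) : Set (Set (Space n)) :=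
  {K | ∃ s ∈ T.faces, s.card = n + 1 ∧ K = convexHull ℝ (s : Set (Space n))}

/-! ### Weak exterior derivatives, boundary integrals and function spaces -/

instance fact_one_le_four : Fact ((1 : ℝ≥0∞) ≤ 4) := ⟨by norm_num⟩

section Spaces

variable {g : Type*} [NormedAddCommGroup g] [InnerProductSpace ℝ g] {n : ℕ}

/-- The boundary integral `∫_{∂K} ⟨u ∧ v⟩`, which for forms of low regularity with weak exterior
derivatives `du`, `dv` is defined as `∫_K (⟨du ∧ v⟩ + (-1)ᵏ ⟨u ∧ dv⟩)`. -/
def bdryInt {k l : ℕ} (h : k + 1 + l = n) (K : Set (Space n))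
    (u : Space n → Form n k g) (du : Space n → Form n (k + 1) g)
    (v : Space n → Form n l g) (dv : Space n → Form n (l + 1) g) : ℝ :=
  ∫ x in K, (pair h (du x) (v x) + (-1) ^ k * pair (by omega) (u x) (dv x))

/-- `w` is the weak (distributional) exterior derivative of `u` on the open set `U`. -/
def IsWeakD {k : ℕ} (U : Set (Space n)) (u : Space n → Form n k g)
    (w : Space n → Form n (k + 1) g) : Prop :=
  ∀ (l : ℕ) (h : k + 1 + l = n) (η : Space n → Form n l g),
    ContDiff ℝ ∞ η → HasCompactSupport η → tsupport η ⊆ U →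
      bdryInt h U u w η (extDeriv η) = 0

variable (g)

/-- `Lᵖ` forms on `Ω`. -/
abbrev LpForm (Ω : Set (Space n)) (k : ℕ) (p : ℝ≥0∞) : Type _ :=
  Lp (Form n k g) p (volume.restrict Ω)

/-- Pairs of an `Lᵖ` `k`-form and an `L^q` `(k+1)`-form.  A space of forms `u ∈ Lᵖ` with
`du ∈ L^q` is represented by its graph, the set of the pairs `(u, du)`, and so carries the graph
norm. -/
abbrev FormPair (Ω : Set (Space n)) (k : ℕ) (p q : ℝ≥0∞) : Type _ :=
  LpForm g Ω k p × LpForm g Ω (k + 1) q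

/-- `{u ∈ Lᵖ Λᵏ(Ω) : du ∈ L^q Λᵏ⁺¹(Ω)}`. -/
def Conf (Ω : Set (Space n)) (k : ℕ) (p q : ℝ≥0∞) : Set (FormPair g Ω k p q) :=
  {u | IsWeakD Ω u.1 u.2}

/-- `{u ∈ Lᵖ Λᵏ(Ω) : d(u|_K) ∈ L^q Λᵏ⁺¹(K) for all elements K}`. -/
def Broken (Ω : Set (Space n)) (T : Geometry.SimplicialComplex ℝ (Space n)) (k : ℕ)
    (p q : ℝ≥0∞) : Set (FormPair g Ω k p q) :=
  {u | ∀ K ∈ elements T, IsWeakD (interior K) u.1 u.2}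

/-- `V⁰`. -/
def V0 (Ω : Set (Space n)) : Set (FormPair g Ω 0 ⊤ 4) := Conf g Ω 0 ⊤ 4

/-- `V¹`. -/
def V1 (Ω : Set (Space n)) : Set (FormPair g Ω 1 4 2) := Conf g Ω 1 4 2

/-- `DV⁰`. -/
def DV0 (Ω : Set (Space n)) (T : Geometry.SimplicialComplex ℝ (Space n)) :
    Set (FormPair g Ω 0 ⊤ 4) := Broken g Ω T 0 ⊤ 4

/-- `DV¹`. -/
def DV1 (Ω : Set (Space n)) (T : Geometry.SimplicialComplex ℝ (Space n)) :
    Set (FormPair g Ω 1 4 2) := Broken g Ω T 1 4 2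

variable {m : ℕ}

/-- The multiplier space `V̂ⁿ⁻¹`, in dimension `n = m + 2`. -/
def VhatD (Ω : Set (Space (m + 2))) : Set (FormPair g Ω (m + 1) (4 / 3) 1) :=
  Conf g Ω (m + 1) (4 / 3) 1

/-- The multiplier space `V̂ⁿ⁻²`, in dimension `n = m + 2`. -/
def VhatH (Ω : Set (Space (m + 2))) : Set (FormPair g Ω m 2 (4 / 3)) :=
  Conf g Ω m 2 (4 / 3)

/-- Forms in `V⁰` with vanishing tangential trace on `∂Ω`.  The trace is the functional
`D' ↦ ∫_{∂Ω} ⟨φ, D'⟩` on `V̂ⁿ⁻¹`. -/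
def V0ring (Ω : Set (Space (m + 2))) : Set (FormPair g Ω 0 ⊤ 4) :=
  {φ ∈ V0 g Ω | ∀ D' ∈ VhatD g Ω, bdryInt (by omega) Ω φ.1 φ.2 D'.1 D'.2 = 0}

/-- Forms in `V¹` with vanishing tangential trace on `∂Ω`.  The trace is the functional
`H' ↦ ∫_{∂Ω} ⟨A ∧ H'⟩` on `V̂ⁿ⁻²`. -/
def V1ring (Ω : Set (Space (m + 2))) : Set (FormPair g Ω 1 4 2) :=
  {A ∈ V1 g Ω | ∀ H' ∈ VhatH g Ω, bdryInt (by omega) Ω A.1 A.2 H'.1 H'.2 = 0}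

variable {g}

/-- `τ` is the tangential trace `v|_{∂K}` of an `Lʳ` form `v` on `K` with `dv ∈ Lˢ(K)`, that is the
functional `u ↦ ∫_{∂K} ⟨u ∧ v⟩` on the test space `S`. -/
def HasTangentialTrace {k l : ℕ} {p q : ℝ≥0∞} {Ω : Set (Space n)} (h : k + 1 + l = n)
    (S : Set (FormPair g Ω k p q)) (K : Set (Space n)) (r s : ℝ≥0∞)
    (v : Space n → Form n l g) (τ : S → ℝ) : Prop :=
  MemLp v r (volume.restrict K) ∧
    ∃ dv : Space n → Form n (l + 1) g, MemLp dv s (volume.restrict K) ∧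
      IsWeakD (interior K) v dv ∧ ∀ u : S, τ u = bdryInt h K u.1.1 u.1.2 v dv

/-- `v|_{∂K} = v'|_{∂K}`: both forms have a tangential trace on `∂K`, and it is the same. -/
def SameTrace {k l : ℕ} {p q : ℝ≥0∞} {Ω : Set (Space n)} (h : k + 1 + l = n)
    (S : Set (FormPair g Ω k p q)) (K : Set (Space n)) (r s : ℝ≥0∞)
    (v v' : Space n → Form n l g) : Prop :=
  ∃ τ : S → ℝ, HasTangentialTrace h S K r s v τ ∧ HasTangentialTrace h S K r s v' τ

end Spaces

/-! ### Fields and equations -/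

/-- The conditions on the permittivity (`k = 1`) and on the inverse permeability (`k = 2`): pointwise
symmetric isomorphisms from `k`-forms to `(n-k)`-forms that depend on the point in an `L^∞` way. -/
structure IsMaterialTensor {n k l : ℕ} (h : k + l = n) (Ω : Set (Space n))
    (κ : Space n → Form n k ℝ →L[ℝ] Form n l ℝ) : Prop where
  bijective : ∀ x ∈ closure Ω, Function.Bijective (κ x)
  symmetric : ∀ x ∈ closure Ω, ∀ a b : Form n k ℝ,
    wedge (ContinuousLinearMap.mul ℝ ℝ) h a (κ x b) =
      wedge (ContinuousLinearMap.mul ℝ ℝ) h b (κ x a)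
  memLp : MemLp κ ⊤ (volume.restrict Ω)

section Equations

variable {g : Type*} [NormedLieRing g] [InvariantLieAlgebra g] [FiniteDimensional ℝ g]

/-- The exterior covariant derivative `d_A u = du + [A ∧ u]` at a point. -/
def covD {n k : ℕ} (A : Form n 1 g) (u : Form n k g) (du : Form n (k + 1) g) :
    Form n (k + 1) g :=
  du + brk (by omega) A u

/-- The curvature `F_A = dA + ½ [A ∧ A]` at a point. -/
def curvature {n : ℕ} (A : Form n 1 g) (dA : Form n 2 g) : Form n 2 g :=
  dA + (1 / 2 : ℝ) • brk (by omega) A A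

variable {m : ℕ} {Ω : Set (Space (m + 2))}

/-- `E = -(Ȧ + d_A φ)`, with derivatives in space taken elementwise. -/
def electricField (I : Set ℝ) (A : ℝ → FormPair g Ω 1 4 2) (φ : ℝ → FormPair g Ω 0 ⊤ 4)
    (t : ℝ) (x : Space (m + 2)) : Form (m + 2) 1 g :=
  -((derivWithin A I t).1 x + covD ((A t).1 x) ((φ t).1 x) ((φ t).2 x))

/-- `H = μ⁻¹ B = μ⁻¹ F_A`, with derivatives in space taken elementwise. -/
def magneticField (μinv : Space (m + 2) → Form (m + 2) 2 ℝ →L[ℝ] Form (m + 2) m ℝ)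
    (A : ℝ → FormPair g Ω 1 4 2) (t : ℝ) (x : Space (m + 2)) : Form (m + 2) m g :=
  extendCoeff (μinv x) (curvature ((A t).1 x) ((A t).2 x))

/-- `∫_U (⟨A' ∧ (Ḋ - [φ, D])⟩ - ⟨d_A A' ∧ H⟩)` at time `t`. -/
def formA (U : Set (Space (m + 2))) (I : Set ℝ)
    (μinv : Space (m + 2) → Form (m + 2) 2 ℝ →L[ℝ] Form (m + 2) m ℝ)
    (A : ℝ → FormPair g Ω 1 4 2) (φ : ℝ → FormPair g Ω 0 ⊤ 4) (D : ℝ → LpForm g Ω (m + 1) 4)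
    (t : ℝ) (A' : FormPair g Ω 1 4 2) : ℝ :=
  ∫ x in U, (pair (by omega) (A'.1 x)
        (derivWithin D I t x - brk (by omega) ((φ t).1 x) (D t x) : Form (m + 2) (m + 1) g) -
      pair (by omega) (covD ((A t).1 x) (A'.1 x) (A'.2 x)) (magneticField μinv A t x))

/-- `∫_U (⟨d_A φ' ∧ D⟩ + ⟨φ', ρ⟩)` at time `t`. -/
def formφ (U : Set (Space (m + 2))) (A : ℝ → FormPair g Ω 1 4 2)
    (D : ℝ → LpForm g Ω (m + 1) 4) (ρ : ℝ → LpForm g Ω (m + 2) 1)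
    (t : ℝ) (φ' : FormPair g Ω 0 ⊤ 4) : ℝ :=
  ∫ x in U, (pair (by omega) (covD ((A t).1 x) (φ'.1 x) (φ'.2 x)) (D t x) +
      pair (by omega) (φ'.1 x) (ρ t x))

/-- `(A, φ)` solves the weak Yang–Mills (Euler–Lagrange) equations on the time interval `I`, with
zero tangential traces on `∂Ω`. -/
structure SolvesYM (I : Set ℝ)
    (μinv : Space (m + 2) → Form (m + 2) 2 ℝ →L[ℝ] Form (m + 2) m ℝ)
    (A : ℝ → FormPair g Ω 1 4 2) (φ : ℝ → FormPair g Ω 0 ⊤ 4) (D : ℝ → LpForm g Ω (m + 1) 4)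
    (ρ : ℝ → LpForm g Ω (m + 2) 1) : Prop where
  contDiffOn_A : ContDiffOn ℝ 1 A I
  mem_A : ∀ t ∈ I, A t ∈ V1ring g Ω
  continuousOn_φ : ContinuousOn φ I
  mem_φ : ∀ t ∈ I, φ t ∈ V0ring g Ω
  eq_A : ∀ t ∈ I, ∀ A' ∈ V1ring g Ω, formA Ω I μinv A φ D t A' = 0
  eq_φ : ∀ t ∈ I, ∀ φ' ∈ V0ring g Ω, formφ Ω A D ρ t φ' = 0

/-- `(A, φ, Ĥ, D̂)` solves the domain-decomposed Euler–Lagrange equations on `I`. -/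
structure SolvesDD (T : Geometry.SimplicialComplex ℝ (Space (m + 2))) (I : Set ℝ)
    (μinv : Space (m + 2) → Form (m + 2) 2 ℝ →L[ℝ] Form (m + 2) m ℝ)
    (A : ℝ → FormPair g Ω 1 4 2) (φ : ℝ → FormPair g Ω 0 ⊤ 4) (D : ℝ → LpForm g Ω (m + 1) 4)
    (ρ : ℝ → LpForm g Ω (m + 2) 1)
    (Hhat : ℝ → FormPair g Ω m 2 (4 / 3)) (Dhat : ℝ → FormPair g Ω (m + 1) (4 / 3) 1) :
    Prop where
  contDiffOn_A : ContDiffOn ℝ 1 A I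
  mem_A : ∀ t ∈ I, A t ∈ DV1 g Ω T
  continuousOn_φ : ContinuousOn φ I
  mem_φ : ∀ t ∈ I, φ t ∈ DV0 g Ω T
  mem_Hhat : ∀ t ∈ I, Hhat t ∈ VhatH g Ω
  mem_Dhat : ∀ t ∈ I, Dhat t ∈ VhatD g Ω
  eq_A : ∀ t ∈ I, ∀ K ∈ elements T, ∀ A' ∈ DV1 g Ω T,
    formA K I μinv A φ D t A' + bdryInt (by omega) K A'.1 A'.2 (Hhat t).1 (Hhat t).2 = 0
  eq_φ : ∀ t ∈ I, ∀ K ∈ elements T, ∀ φ' ∈ DV0 g Ω T,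
    formφ K A D ρ t φ' - bdryInt (by omega) K φ'.1 φ'.2 (Dhat t).1 (Dhat t).2 = 0
  continuity_A : ∀ t ∈ I, ∀ H' ∈ VhatH g Ω,
    ∑ᶠ K ∈ elements T, bdryInt (by omega) K (A t).1 (A t).2 H'.1 H'.2 = 0
  continuity_φ : ∀ t ∈ I, ∀ D' ∈ VhatD g Ω,
    ∑ᶠ K ∈ elements T, bdryInt (by omega) K (φ t).1 (φ t).2 D'.1 D'.2 = 0

end Equations

end YM

end

/-!
Invariance of the inner product moves the bracket in `d_A` across the pairing. Hence at each time
the two weak equations are the boundary pairings of the test forms with `(H, Ḋ - [φ, D] - [A ∧ H])`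
and `(D, ρ - [A ∧ D])`. Compactly supported smooth test forms show that the second components of
these pairs are the weak exterior derivatives of the first ones, so `H` and `D` have tangential
traces on every element, and the elementwise equations say that the multipliers have the same
traces. The elements cover `Ω` up to a null set and overlap in null sets, so summing over them gives
the pairings over `Ω`; testing with smooth multipliers as well, the continuity conditions say that
`A` and `φ` are conforming with zero trace on `∂Ω`.
-/

noncomputable section

namespace YM

/-! ### Algebra of the exterior product -/

section Alternate

open Equiv

variable {ι X F : Type*} [Fintype ι] [DecidableEq ι] [AddCommGroup F]

/-- The unnormalized antisymmetrization `∑ σ, sign σ • f (x ∘ σ)` of a function of several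
variables.  Unlike `MultilinearMap.alternatization` it applies to functions that are not known to be
multilinear. -/
def alternate (f : (ι → X) → F) (x : ι → X) : F := ∑ σ : Perm ι, Perm.sign σ • f (x ∘ σ)

theorem alternate_comp_perm (f : (ι → X) → F) (τ : Perm ι) :
    alternate (fun x => f (x ∘ τ)) = Perm.sign τ • alternate f := by
  ext x
  simp only [alternate, Pi.smul_apply, Finset.smul_sum]
  refine Fintype.sum_equiv (Equiv.mulRight τ) _ _ fun σ => ?_
  rw [Equiv.coe_mulRight, Perm.sign_mul, smul_smul, mul_left_comm, Int.units_mul_self, mul_one,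
    Function.comp_assoc, Perm.coe_mul]

theorem alternate_smul {R : Type*} [Monoid R] [DistribMulAction R F] [SMulCommClass ℤˣ R F]
    (c : R) (f : (ι → X) → F) : alternate (c • f) = c • alternate f := by
  ext x
  simp only [alternate, Pi.smul_apply, Finset.smul_sum, smul_comm c]

theorem alternate_sum {κ : Type*} (s : Finset κ) (f : κ → (ι → X) → F) :
    alternate (∑ i ∈ s, f i) = ∑ i ∈ s, alternate (f i) := by
  ext x
  simp only [alternate, Finset.sum_apply, Finset.smul_sum]
  exact Finset.sum_comm

theorem alternate_alternatingMap [Module ℝ F] {E : Type*} [AddCommGroup E] [Module ℝ E]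
    (f : E [⋀^ι]→ₗ[ℝ] F) : alternate f = ((Fintype.card ι).factorial : ℝ) • ⇑f := by
  ext x
  have h : ∀ σ : Perm ι, Perm.sign σ • f (x ∘ σ) = f x := fun σ => by
    rw [f.map_perm, smul_smul, Int.units_mul_self, one_smul]
  simp [alternate, h, Fintype.card_perm, Nat.cast_smul_eq_nsmul]

theorem norm_alternate_le {X F : Type*} [SeminormedAddCommGroup X] [NormedAddCommGroup F]
    {f : (ι → X) → F} {C : ℝ} (hf : ∀ x, ‖f x‖ ≤ C * ∏ i, ‖x i‖) (x : ι → X) :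
    ‖alternate f x‖ ≤ (Fintype.card ι).factorial * C * ∏ i, ‖x i‖ := by
  have h : ∀ σ ∈ Finset.univ, ‖Perm.sign σ • f (x ∘ σ)‖ ≤ C * ∏ i, ‖x i‖ := by
    intro σ _
    rw [← Equiv.prod_comp σ]
    rcases Int.units_eq_one_or (Perm.sign σ) with h | h <;>
      simpa [h, Units.smul_def] using hf (x ∘ σ)
  simpa [alternate, Fintype.card_perm, mul_assoc] using norm_sum_le_of_le Finset.univ h

end Alternate

section Wedge

open Equiv

variable {F₁ F₂ F₃ F₄ F₅ : Type*} [NormedAddCommGroup F₁] [NormedSpace ℝ F₁]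
  [NormedAddCommGroup F₂] [NormedSpace ℝ F₂] [NormedAddCommGroup F₃] [NormedSpace ℝ F₃]
  [NormedAddCommGroup F₄] [NormedSpace ℝ F₄] [NormedAddCommGroup F₅] [NormedSpace ℝ F₅]

/-- The identification of the disjoint union of the first `k` and the last `l` indices with the set
of all indices, along which `wedge` is defined. -/
def blockEquiv {k l j : ℕ} (h : k + l = j) : Fin k ⊕ Fin l ≃ Fin j :=
  finSumFinEquiv.trans (finCongr h)

@[simp]
theorem val_blockEquiv_inl {k l j : ℕ} (h : k + l = j) (i : Fin k) :
    (blockEquiv h (Sum.inl i) : ℕ) = i := rfl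

@[simp]
theorem val_blockEquiv_inr {k l j : ℕ} (h : k + l = j) (i : Fin l) :
    (blockEquiv h (Sum.inr i) : ℕ) = k + i := rfl

/-- The tensor product of a function of `k` and a function of `l` variables, with values multiplied
by `β`. -/
def tensor {X : Type*} {k l j : ℕ} (β : F₁ →L[ℝ] F₂ →L[ℝ] F₃) (h : k + l = j)
    (a : (Fin k → X) → F₁) (b : (Fin l → X) → F₂) (x : Fin j → X) : F₃ :=
  β (a fun i => x (blockEquiv h (Sum.inl i))) (b fun i => x (blockEquiv h (Sum.inr i)))

theorem tensor_alternate {X : Type*} {k l j : ℕ} (β : F₁ →L[ℝ] F₂ →L[ℝ] F₃) (h : k + l = j)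
    (a : (Fin k → X) → F₁) (b : (Fin l → X) → F₂) :
    tensor β h (alternate a) (alternate b) =
      ∑ σ : Perm (Fin k), ∑ τ : Perm (Fin l), (Perm.sign σ * Perm.sign τ) •
        fun x => tensor β h a b (x ∘ (blockEquiv h).permCongr (Perm.sumCongr σ τ)) := by
  ext x
  simp only [tensor, alternate, Units.smul_def, map_sum, map_zsmul, sum_apply,
    smul_apply, Finset.sum_apply, Pi.smul_apply, Finset.smul_sum, smul_smul,
    Units.val_mul]
  rw [Finset.sum_comm]
  simp [Function.comp_def, mul_comm]

theorem alternate_tensor_alternate {X : Type*} {k l j : ℕ} (β : F₁ →L[ℝ] F₂ →L[ℝ] F₃)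
    (h : k + l = j) (a : (Fin k → X) → F₁) (b : (Fin l → X) → F₂) :
    alternate (tensor β h (alternate a) (alternate b)) =
      ((k.factorial : ℝ) * l.factorial) • alternate (tensor β h a b) := by
  rw [tensor_alternate, alternate_sum]
  simp only [alternate_sum, alternate_smul, alternate_comp_perm, Perm.sign_permCongr,
    Perm.sign_sumCongr, smul_smul, Int.units_mul_self, one_smul, Finset.sum_const,
    Finset.card_univ, Fintype.card_perm, Fintype.card_fin]
  rw [← Nat.cast_smul_eq_nsmul ℝ, Nat.cast_mul]

theorem wedge_eq_smul_alternate {n k l j : ℕ} (β : F₁ →L[ℝ] F₂ →L[ℝ] F₃) (h : k + l = j)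
    (u : Form n k F₁) (v : Form n l F₂) :
    ⇑(wedge β h u v) = ((k.factorial : ℝ) * l.factorial)⁻¹ • alternate (tensor β h u v) := by
  rw [eq_inv_smul_iff₀ (by positivity)]
  ext x
  have hdom := congrArg (fun f => TensorProduct.lift β.toLinearMap₁₂ (f (x ∘ blockEquiv h)))
    (MultilinearMap.domCoprod_alternization_eq u.toAlternatingMap v.toAlternatingMap)
  simp only [Fintype.card_fin, AlternatingMap.smul_apply, map_nsmul,
    MultilinearMap.alternatization_apply, map_sum] at hdom
  rw [Pi.smul_apply, ← Nat.cast_mul, Nat.cast_smul_eq_nsmul]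
  refine hdom.symm.trans ?_
  rw [alternate, ← (blockEquiv h).permCongr.sum_comp]
  refine Finset.sum_congr rfl fun σ _ => ?_
  rw [Units.smul_def, map_zsmul, ← Units.smul_def, Perm.sign_permCongr]
  simp [tensor]

theorem Form.eq_smul_alternate {n k : ℕ} (u : Form n k F₁) :
    ⇑u = (k.factorial : ℝ)⁻¹ • alternate u := by
  rw [eq_inv_smul_iff₀ (by positivity)]
  simpa using (alternate_alternatingMap u.toAlternatingMap).symm

theorem wedge_of_eq_smul_alternate {n k l j : ℕ} (β : F₁ →L[ℝ] F₂ →L[ℝ] F₃) (h : k + l = j)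
    {u : Form n k F₁} {v : Form n l F₂} {a : (Fin k → Space n) → F₁} {b : (Fin l → Space n) → F₂}
    {c d : ℝ} (hu : ⇑u = c • alternate a) (hv : ⇑v = d • alternate b) :
    ⇑(wedge β h u v) = (c * d) • alternate (tensor β h a b) := by
  have htensor : tensor β h (c • alternate a) (d • alternate b) =
      (c * d) • tensor β h (alternate a) (alternate b) := by
    ext x
    simp [tensor, smul_smul, mul_comm c]
  rw [wedge_eq_smul_alternate, hu, hv, htensor, alternate_smul, alternate_tensor_alternate,
    smul_comm (c * d), inv_smul_smul₀ (by positivity)]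

theorem wedge_assoc {F₆ : Type*} [NormedAddCommGroup F₆] [NormedSpace ℝ F₆]
    {β₁ : F₁ →L[ℝ] F₂ →L[ℝ] F₄} {β₂ : F₄ →L[ℝ] F₃ →L[ℝ] F₅} {β₃ : F₂ →L[ℝ] F₃ →L[ℝ] F₆}
    {β₄ : F₁ →L[ℝ] F₆ →L[ℝ] F₅} (hβ : ∀ x y z, β₂ (β₁ x y) z = β₄ x (β₃ y z))
    {n k l p a b j : ℕ} (hkl : k + l = a) (hap : a + p = j) (hlp : l + p = b) (hkb : k + b = j)
    (u : Form n k F₁) (v : Form n l F₂) (w : Form n p F₃) :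
    wedge β₂ hap (wedge β₁ hkl u v) w = wedge β₄ hkb u (wedge β₃ hlp v w) := by
  have hinl : ∀ i, blockEquiv hap (.inl (blockEquiv hkl (.inl i))) = blockEquiv hkb (.inl i) :=
    fun i => rfl
  have hmid : ∀ i, blockEquiv hap (.inl (blockEquiv hkl (.inr i))) =
      blockEquiv hkb (.inr (blockEquiv hlp (.inl i))) := fun i => rfl
  have hinr : ∀ i, blockEquiv hap (.inr i) = blockEquiv hkb (.inr (blockEquiv hlp (.inr i))) :=
    fun i => Fin.ext (by simp only [val_blockEquiv_inr]; lia)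
  have htensor : tensor β₂ hap (tensor β₁ hkl u v) w = tensor β₄ hkb u (tensor β₃ hlp v w) := by
    ext x
    simp only [tensor, hβ, hinl, hmid, hinr]
  apply DFunLike.coe_injective
  rw [wedge_of_eq_smul_alternate β₂ hap (wedge_eq_smul_alternate β₁ hkl u v) w.eq_smul_alternate,
    wedge_of_eq_smul_alternate β₄ hkb u.eq_smul_alternate (wedge_eq_smul_alternate β₃ hlp v w),
    htensor, mul_inv, mul_inv, mul_assoc]

theorem val_finRotate_pow {j : ℕ} (a : ℕ) (i : Fin j) :
    ((finRotate j ^ a) i : ℕ) = (i + a) % j := by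
  rcases j with _ | j
  · exact i.elim0
  induction a with
  | zero => simp [Nat.mod_eq_of_lt i.2]
  | succ a ih =>
    rw [pow_succ', Perm.mul_apply, finRotate_apply, Fin.val_add, ih]
    simp [Nat.add_mod, ← add_assoc]

theorem sign_finRotate_pow (k l : ℕ) : Perm.sign (finRotate (l + k) ^ l) = (-1) ^ (k * l) := by
  rcases l with _ | l
  · simp
  rw [map_pow, sign_finRotate, ← pow_mul,
    show (l + 1 + k - 1) * (l + 1) = l * (l + 1) + k * (l + 1) by
      rw [show l + 1 + k - 1 = l + k by lia]; ring,
    pow_add, (Nat.even_mul_succ_self l).neg_one_pow, one_mul]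

theorem wedge_comm {n k l j : ℕ} (β : F₁ →L[ℝ] F₂ →L[ℝ] F₃) (h : k + l = j) (h' : l + k = j)
    (u : Form n k F₁) (v : Form n l F₂) :
    wedge β h u v = (-1 : ℝ) ^ (k * l) • wedge β.flip h' v u := by
  subst h'
  have hinl : ∀ i, (finRotate (l + k) ^ l) (blockEquiv h (.inl i)) = blockEquiv rfl (.inr i) :=
    fun i => Fin.ext (by
      rw [val_finRotate_pow, val_blockEquiv_inl, val_blockEquiv_inr, Nat.mod_eq_of_lt] <;> lia)
  have hinr : ∀ i, (finRotate (l + k) ^ l) (blockEquiv h (.inr i)) = blockEquiv rfl (.inl i) :=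
    fun i => Fin.ext (by
      rw [val_finRotate_pow, val_blockEquiv_inl, val_blockEquiv_inr,
        show k + (i : ℕ) + l = i + (l + k) by lia, Nat.add_mod_right, Nat.mod_eq_of_lt]
      lia)
  have htensor : tensor β.flip rfl v u =
      fun x => tensor β h u v (x ∘ ⇑(finRotate (l + k) ^ l)) := by
    ext x
    simp only [tensor, Function.comp_apply, hinl, hinr, ContinuousLinearMap.flip_apply]
  apply DFunLike.coe_injective
  rw [ContinuousAlternatingMap.coe_smul, wedge_eq_smul_alternate, wedge_eq_smul_alternate, htensor,
    alternate_comp_perm, sign_finRotate_pow]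
  rcases Nat.even_or_odd (k * l) with hkl | hkl <;>
    simp [hkl.neg_one_pow, mul_comm (k.factorial : ℝ)]

theorem wedge_zero_right {n k : ℕ} (β : F₁ →L[ℝ] F₂ →L[ℝ] F₃) (h : k + 0 = k)
    (u : Form n k F₁) (v : Form n 0 F₂) :
    wedge β h u v = (β.flip (v Fin.elim0)).compContinuousAlternatingMap u := by
  have htensor : tensor β h u v = (β.flip (v Fin.elim0)).compContinuousAlternatingMap u := by
    ext x
    simp only [tensor, ContinuousLinearMap.compContinuousAlternatingMap_coe, Function.comp_apply,
      ContinuousLinearMap.flip_apply]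
    exact congrArg (β (u x)) (congrArg v (Subsingleton.elim _ _))
  apply DFunLike.coe_injective
  rw [wedge_eq_smul_alternate, htensor, Nat.factorial_zero, Nat.cast_one, mul_one,
    ← Form.eq_smul_alternate]

theorem norm_wedge_le {n k l j : ℕ} (β : F₁ →L[ℝ] F₂ →L[ℝ] F₃) (h : k + l = j)
    (u : Form n k F₁) (v : Form n l F₂) :
    ‖wedge β h u v‖ ≤ j.factorial * ‖β‖ * ‖u‖ * ‖v‖ := by
  have htensor : ∀ x, ‖tensor β h u v x‖ ≤ ‖β‖ * ‖u‖ * ‖v‖ * ∏ i, ‖x i‖ := by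
    intro x
    calc ‖tensor β h u v x‖
        ≤ ‖β‖ * (‖u‖ * ∏ i, ‖x (blockEquiv h (.inl i))‖) *
          (‖v‖ * ∏ i, ‖x (blockEquiv h (.inr i))‖) :=
          β.le_of_opNorm₂_le_of_le le_rfl (u.le_opNorm _) (v.le_opNorm _)
      _ = ‖β‖ * ‖u‖ * ‖v‖ * ∏ i, ‖x i‖ := by
          rw [← (blockEquiv h).prod_comp, Fintype.prod_sum_type]
          ring
  refine ContinuousAlternatingMap.opNorm_le_bound _ (by positivity) fun x => ?_
  have hnorm : ‖((k.factorial : ℝ) * l.factorial)⁻¹‖ ≤ 1 := by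
    rw [← Nat.cast_mul, norm_inv, Real.norm_natCast]
    exact inv_le_one_of_one_le₀ (mod_cast Nat.mul_pos k.factorial_pos l.factorial_pos)
  rw [wedge_eq_smul_alternate, Pi.smul_apply, norm_smul]
  calc _ ≤ 1 * ((Fintype.card (Fin j)).factorial * (‖β‖ * ‖u‖ * ‖v‖) * ∏ i, ‖x i‖) := by
        gcongr
        exact norm_alternate_le htensor x
    _ = j.factorial * ‖β‖ * ‖u‖ * ‖v‖ * ∏ i, ‖x i‖ := by
        rw [Fintype.card_fin]
        ring

/-- The exterior product `wedge` as a continuous bilinear map. -/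
def wedgeL (n : ℕ) {k l j : ℕ} (β : F₁ →L[ℝ] F₂ →L[ℝ] F₃) (h : k + l = j) :
    Form n k F₁ →L[ℝ] Form n l F₂ →L[ℝ] Form n j F₃ :=
  LinearMap.mkContinuous₂ (LinearMap.mk₂ ℝ (wedge β h)
    (fun u u' v => by
      ext x
      simp [wedge_eq_smul_alternate, alternate, tensor, Finset.sum_add_distrib])
    (fun c u v => by
      ext x
      simp [wedge_eq_smul_alternate, alternate, tensor, smul_comm _ c, ← Finset.smul_sum])
    (fun u v v' => by
      ext x
      simp [wedge_eq_smul_alternate, alternate, tensor, Finset.sum_add_distrib])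
    (fun c u v => by
      ext x
      simp [wedge_eq_smul_alternate, alternate, tensor, smul_comm _ c, ← Finset.smul_sum]))
    (j.factorial * ‖β‖) (norm_wedge_le β h)

theorem wedgeL_apply {n k l j : ℕ} (β : F₁ →L[ℝ] F₂ →L[ℝ] F₃) (h : k + l = j)
    (u : Form n k F₁) (v : Form n l F₂) : wedgeL n β h u v = wedge β h u v := rfl

/-- A covector as a real `1`-form. -/
def oneForm {n : ℕ} (a : Space n →L[ℝ] ℝ) : Form n 1 ℝ :=
  ContinuousAlternatingMap.ofSubsingleton ℝ (Space n) ℝ (0 : Fin 1) a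

theorem factorial_smul_alternatizeUncurryFin {n k : ℕ} (f : Space n →L[ℝ] Form n k F₁) :
    (k.factorial : ℝ) • ⇑(ContinuousAlternatingMap.alternatizeUncurryFin f) =
      alternate fun x : Fin (k + 1) → Space n => f (x 0) (Fin.tail x) := by
  -- All `k + 1` terms of `alternatizeUncurryFin` have the same antisymmetrization.
  have hterm (i : Fin (k + 1)) :
      alternate ((-1 : ℤˣ) ^ (i : ℕ) • fun x : Fin (k + 1) → Space n => f (x i) (i.removeNth x)) =
        alternate fun x : Fin (k + 1) → Space n => f (x 0) (Fin.tail x) := by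
    have hcycle : (fun x : Fin (k + 1) → Space n => f (x i) (i.removeNth x)) =
        fun x => f ((x ∘ i.cycleRange.symm) 0) (Fin.tail (x ∘ i.cycleRange.symm)) := by
      ext x
      simp [Fin.tail_def, Fin.cycleRange_symm_succ]
      rfl
    rw [alternate_smul, hcycle, alternate_comp_perm fun x => f (x 0) (Fin.tail x), smul_smul,
      Perm.sign_symm, Fin.sign_cycleRange, Int.units_mul_self, one_smul]
  have hsum : ⇑(ContinuousAlternatingMap.alternatizeUncurryFin f) =
      ∑ i : Fin (k + 1), (-1 : ℤˣ) ^ (i : ℕ) •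
        fun x : Fin (k + 1) → Space n => f (x i) (i.removeNth x) := by
    ext x
    simp [ContinuousAlternatingMap.alternatizeUncurryFin_apply, Units.smul_def]
  have halt := alternate_alternatingMap
    (ContinuousAlternatingMap.alternatizeUncurryFin f).toAlternatingMap
  rw [ContinuousAlternatingMap.coe_toAlternatingMap, Fintype.card_fin, hsum, alternate_sum,
    Finset.sum_congr rfl fun i _ => hterm i, ← hsum, Finset.sum_const, Finset.card_univ,
    Fintype.card_fin, Nat.factorial_succ, Nat.cast_mul, mul_smul,
    ← Nat.cast_smul_eq_nsmul ℝ] at halt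
  exact (smul_right_injective _ (by positivity : ((k + 1 : ℕ) : ℝ) ≠ 0) halt).symm

theorem alternatizeUncurryFin_smulRight {n k : ℕ} (h : 1 + k = k + 1) (a : Space n →L[ℝ] ℝ)
    (b : Form n k F₁) :
    ContinuousAlternatingMap.alternatizeUncurryFin (a.smulRight b) =
      wedge (ContinuousLinearMap.lsmul ℝ ℝ) h (oneForm a) b := by
  have htensor : tensor (ContinuousLinearMap.lsmul ℝ ℝ) h (oneForm a) b =
      fun x => a.smulRight b (x 0) (Fin.tail x) := by
    ext x
    have hzero : blockEquiv h (.inl 0) = 0 := rfl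
    have hsucc (i : Fin k) : blockEquiv h (.inr i) = i.succ := Fin.ext (by simp [add_comm])
    simp [tensor, oneForm, hzero, hsucc, Fin.tail_def]
  apply DFunLike.coe_injective
  rw [wedge_eq_smul_alternate, htensor, ← factorial_smul_alternatizeUncurryFin, Nat.factorial_one,
    Nat.cast_one, one_mul, inv_smul_smul₀ (by positivity)]

end Wedge

section Pairing

variable {g : Type*} [NormedAddCommGroup g] [InnerProductSpace ℝ g] {n : ℕ}

/-- The pairing `pair` of forms of complementary degrees as a continuous bilinear map. -/
def pairL (g : Type*) [NormedAddCommGroup g] [InnerProductSpace ℝ g] {n k l : ℕ} (h : k + l = n) :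
    Form n k g →L[ℝ] Form n l g →L[ℝ] ℝ :=
  (ContinuousLinearMap.compL ℝ (Form n l g) (Form n n ℝ) ℝ
    (ContinuousAlternatingMap.apply ℝ (Space n) ℝ fun i => EuclideanSpace.single i 1)) ∘L
      wedgeL n (innerSL ℝ) h

theorem pairL_apply {k l : ℕ} (h : k + l = n) (u : Form n k g) (v : Form n l g) :
    pairL g h u v = pair h u v := rfl

theorem pair_comm {k l : ℕ} (h : k + l = n) (h' : l + k = n) (u : Form n k g) (v : Form n l g) :
    pair h u v = (-1) ^ (k * l) * pair h' v u := by
  have hsymm : (innerSL ℝ : g →L[ℝ] g →L[ℝ] ℝ).flip = innerSL ℝ := by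
    ext x y
    simp
  rw [pair, wedge_comm _ h h', hsymm]
  rfl

theorem pair_alternatizeUncurryFin_smulRight {k l : ℕ} (h : k + 1 + l = n) (h' : k + (l + 1) = n)
    (c : Space n →L[ℝ] ℝ) (a : Form n k g) (b : Form n l g) :
    pair h (ContinuousAlternatingMap.alternatizeUncurryFin (c.smulRight a)) b =
      (-1) ^ k * pair h' a (ContinuousAlternatingMap.alternatizeUncurryFin (c.smulRight b)) := by
  have hassoc := wedge_assoc (n := n)
    (β₁ := (ContinuousLinearMap.lsmul ℝ ℝ : ℝ →L[ℝ] g →L[ℝ] g).flip) (β₂ := innerSL ℝ)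
    (β₃ := (ContinuousLinearMap.lsmul ℝ ℝ : ℝ →L[ℝ] g →L[ℝ] g)) (β₄ := innerSL ℝ)
    (fun x y z => by simp) rfl h (add_comm 1 l) h' a (oneForm c) b
  rw [alternatizeUncurryFin_smulRight (by lia), alternatizeUncurryFin_smulRight (by lia),
    wedge_comm _ _ rfl, pair, pair, ← hassoc, one_mul, ← wedgeL_apply (innerSL ℝ), map_smul,
    smul_apply]
  rfl

theorem eq_zero_of_alternatizeUncurryFin_smulRight {F : Type*} [NormedAddCommGroup F]
    [NormedSpace ℝ F] {k : ℕ} (hk : k < n) {w : Form n k F}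
    (hw : ∀ c : Space n →L[ℝ] ℝ,
      ContinuousAlternatingMap.alternatizeUncurryFin (c.smulRight w) = 0) : w = 0 := by
  apply ContinuousAlternatingMap.toAlternatingMap_injective
  refine Module.Basis.ext_alternating (EuclideanSpace.basisFun (Fin n) ℝ).toBasis fun s _ => ?_
  obtain ⟨i, hi⟩ : ∃ i, ∀ j, i ≠ s j := by
    by_contra! hsurj
    have hcard := Fintype.card_le_of_surjective s fun i => (hsurj i).imp fun _ h => h.symm
    simp only [Fintype.card_fin] at hcard
    lia
  have heval := congrArg (fun f => f (Fin.cons (EuclideanSpace.single i 1)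
    (fun j => EuclideanSpace.single (s j) 1))) (hw (EuclideanSpace.proj i))
  simp only [ContinuousAlternatingMap.alternatizeUncurryFin_apply, Fin.sum_univ_succ] at heval
  simpa [hi] using heval

theorem Form.eq_zero_of_apply_basis_eq_zero {F : Type*} [NormedAddCommGroup F] [NormedSpace ℝ F]
    {w : Form n n F} (hw : w (fun i => EuclideanSpace.single i 1) = 0) : w = 0 := by
  apply ContinuousAlternatingMap.toAlternatingMap_injective
  refine Module.Basis.ext_alternating (EuclideanSpace.basisFun (Fin n) ℝ).toBasis fun s hs => ?_
  have hperm := w.toAlternatingMap.map_perm (fun i => EuclideanSpace.single i 1)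
    (Equiv.ofBijective s (Finite.injective_iff_bijective.1 hs))
  rw [ContinuousAlternatingMap.coe_toAlternatingMap, hw, smul_zero] at hperm
  simpa [Function.comp_def] using hperm

theorem eq_zero_of_pair_eq_zero {k l : ℕ} (h : k + l = n) {w : Form n k g}
    (hw : ∀ b : Form n l g, pair h w b = 0) : w = 0 := by
  induction l generalizing k with
  | zero =>
    obtain rfl : k = n := by lia
    have hself := hw (ContinuousAlternatingMap.constOfIsEmpty ℝ (Space k) (Fin 0)
      (w fun i => EuclideanSpace.single i 1))
    rw [pair, coeff, wedge_zero_right] at hself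
    exact Form.eq_zero_of_apply_basis_eq_zero ((inner_self_eq_zero (𝕜 := ℝ)).1 hself)
  | succ l ih =>
    refine eq_zero_of_alternatizeUncurryFin_smulRight (by lia) fun c =>
      ih (by lia) fun b => ?_
    rw [pair_alternatizeUncurryFin_smulRight (by lia) h, hw, mul_zero]

end Pairing

section Bracket

variable {g : Type*} [NormedLieRing g] [InvariantLieAlgebra g] [FiniteDimensional ℝ g] {n : ℕ}

theorem bracketL_apply (x y : g) : bracketL g x y = ⁅x, y⁆ := rfl

theorem brk_comm {k l j : ℕ} (h : k + l = j) (h' : l + k = j) (u : Form n k g) (v : Form n l g) :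
    brk h u v = -((-1 : ℝ) ^ (k * l) • brk h' v u) := by
  have hskew : (bracketL g).flip = (-1 : ℝ) • bracketL g := by
    ext x y
    change ⁅y, x⁆ = (-1 : ℝ) • ⁅x, y⁆
    rw [neg_one_smul, lie_skew]
  have hsmul : wedge ((-1 : ℝ) • bracketL g) h' v u = (-1 : ℝ) • wedge (bracketL g) h' v u := by
    ext x
    simp [wedge_eq_smul_alternate, alternate, tensor]
  rw [brk, wedge_comm _ h h', hskew, hsmul, brk, neg_one_smul, smul_neg]

theorem pair_brk {k l p a b : ℕ} (hkl : k + l = a) (hap : a + p = n) (hlp : l + p = b)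
    (hkb : k + b = n) (u : Form n k g) (v : Form n l g) (w : Form n p g) :
    pair hap (brk hkl u v) w = pair hkb u (brk hlp v w) := by
  have hinv : ∀ x y z : g, innerSL ℝ (bracketL g x y) z = innerSL ℝ x (bracketL g y z) := by
    intro x y z
    have h := InvariantLieAlgebra.invariant y x z
    simp only [bracketL_apply, innerSL_apply_apply]
    rw [← lie_skew, inner_neg_left]
    linarith
  exact congrArg coeff (wedge_assoc hinv hkl hap hlp hkb u v w)

end Bracket

/-! ### Weak exterior derivatives -/

section StokesTheorem

theorem integral_fderiv_apply_eq_zero {E : Type*} [NormedAddCommGroup E] [NormedSpace ℝ E]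
    [FiniteDimensional ℝ E] [MeasurableSpace E] [BorelSpace E] {μ : Measure E}
    [μ.IsAddHaarMeasure] {f : E → ℝ} (hf : ContDiff ℝ 1 f) (hc : HasCompactSupport f) (v : E) :
    ∫ x, fderiv ℝ f x v ∂μ = 0 := by
  have hf' : Integrable (fun x => fderiv ℝ f x v) μ :=
    ((hf.continuous_fderiv one_ne_zero).clm_apply continuous_const).integrable_of_hasCompactSupport
      (hc.fderiv_apply ℝ v)
  simpa using integral_mul_fderiv_eq_neg_fderiv_mul_of_integrable (f := fun _ => (1 : ℝ)) (v := v)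
    (μ := μ) (by simp) (by simpa using hf')
    (by simpa using hf.continuous.integrable_of_hasCompactSupport hc)
    (fun x _ => differentiableAt_const _) (fun x _ => hf.differentiable one_ne_zero x)

section ExtDeriv

variable {F : Type*} [NormedAddCommGroup F] [NormedSpace ℝ F] {n k : ℕ}

theorem extDeriv_eq_zero_of_notMem_tsupport {η : Space n → Form n k F} {x : Space n}
    (hx : x ∉ tsupport η) : extDeriv η x = 0 := by
  rw [(notMem_tsupport_iff_eventuallyEq.1 hx).extDeriv_eq]
  simpa using extDeriv_smul (0 : ℝ) (0 : Space n → Form n k F) (x := x)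

theorem continuous_extDeriv {η : Space n → Form n k F} (hη : ContDiff ℝ 1 η) :
    Continuous (extDeriv η) :=
  (ContinuousAlternatingMap.alternatizeUncurryFinCLM ℝ (Space n) F).continuous.comp
    (hη.continuous_fderiv one_ne_zero)

theorem hasCompactSupport_extDeriv {η : Space n → Form n k F} (hη : HasCompactSupport η) :
    HasCompactSupport (extDeriv η) :=
  .intro hη fun _ hx => extDeriv_eq_zero_of_notMem_tsupport hx

theorem extDeriv_eq_sum (η : Space n → Form n k F) (x : Space n) :
    extDeriv η x = ∑ i, ContinuousAlternatingMap.alternatizeUncurryFin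
      ((EuclideanSpace.proj i : Space n →L[ℝ] ℝ).smulRight
        (fderiv ℝ η x (EuclideanSpace.single i 1))) := by
  have hfderiv : fderiv ℝ η x = ∑ i, (EuclideanSpace.proj i : Space n →L[ℝ] ℝ).smulRight
      (fderiv ℝ η x (EuclideanSpace.single i 1)) := by
    ext1 y
    conv_lhs => rw [← (EuclideanSpace.basisFun (Fin n) ℝ).sum_repr y, map_sum]
    simp [sum_apply]
  rw [extDeriv]
  conv_lhs => rw [hfderiv]
  exact map_sum (ContinuousAlternatingMap.alternatizeUncurryFinCLM ℝ (Space n) F) _ _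

end ExtDeriv

variable {g : Type*} [NormedAddCommGroup g] [InnerProductSpace ℝ g] {n k l : ℕ}

/-- The bilinear map `(a, b) ↦ ⟨(c ∧ a) ∧ b⟩` given by a covector `c`, whose coordinate derivatives
make up `d⟨η ∧ ζ⟩`. -/
def covectorPairL (h : k + 1 + l = n) (c : Space n →L[ℝ] ℝ) :
    Form n k g →L[ℝ] Form n l g →L[ℝ] ℝ :=
  pairL g h ∘L ContinuousAlternatingMap.alternatizeUncurryFinCLM ℝ (Space n) g ∘L
    ContinuousLinearMap.smulRightL ℝ (Space n) (Form n k g) c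

theorem covectorPairL_apply (h : k + 1 + l = n) (c : Space n →L[ℝ] ℝ) (a : Form n k g)
    (b : Form n l g) :
    covectorPairL h c a b =
      pair h (ContinuousAlternatingMap.alternatizeUncurryFin (c.smulRight a)) b := rfl

theorem pair_extDeriv_add_pair_extDeriv (h : k + 1 + l = n) (h' : k + (l + 1) = n)
    {η : Space n → Form n k g} {ζ : Space n → Form n l g} {x : Space n}
    (hη : DifferentiableAt ℝ η x) (hζ : DifferentiableAt ℝ ζ x) :
    pair h (extDeriv η x) (ζ x) + (-1) ^ k * pair h' (η x) (extDeriv ζ x) =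
      ∑ i, fderiv ℝ (fun y => covectorPairL h (EuclideanSpace.proj i) (η y) (ζ y)) x
        (EuclideanSpace.single i 1) := by
  have hleft : pair h (extDeriv η x) (ζ x) = ∑ i, covectorPairL h (EuclideanSpace.proj i)
      (fderiv ℝ η x (EuclideanSpace.single i 1)) (ζ x) := by
    rw [← pairL_apply, extDeriv_eq_sum, map_sum, sum_apply]
    rfl
  have hright : (-1) ^ k * pair h' (η x) (extDeriv ζ x) =
      ∑ i, covectorPairL h (EuclideanSpace.proj i) (η x)
        (fderiv ℝ ζ x (EuclideanSpace.single i 1)) := by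
    rw [← pairL_apply, extDeriv_eq_sum, map_sum, Finset.mul_sum]
    refine Finset.sum_congr rfl fun i _ => ?_
    rw [covectorPairL_apply, pair_alternatizeUncurryFin_smulRight h h', pairL_apply]
  rw [hleft, hright, ← Finset.sum_add_distrib]
  refine Finset.sum_congr rfl fun i _ => ?_
  rw [(covectorPairL h (EuclideanSpace.proj i)).fderiv_of_bilinear hη hζ]
  simp [add_comm]

theorem integral_pair_extDeriv_add_pair_extDeriv (h : k + 1 + l = n) (h' : k + (l + 1) = n)
    {η : Space n → Form n k g} {ζ : Space n → Form n l g} (hη : ContDiff ℝ 1 η)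
    (hζ : ContDiff ℝ 1 ζ) (hc : HasCompactSupport ζ) :
    ∫ x, (pair h (extDeriv η x) (ζ x) + (-1) ^ k * pair h' (η x) (extDeriv ζ x)) = 0 := by
  have hcd (i : Fin n) :
      ContDiff ℝ 1 fun y => covectorPairL h (EuclideanSpace.proj i) (η y) (ζ y) := by
    have hL : ContDiff ℝ 1 (covectorPairL (g := g) h (EuclideanSpace.proj i)) :=
      ContinuousLinearMap.contDiff _
    exact (hL.comp hη).clm_apply hζ
  have hcs (i : Fin n) :
      HasCompactSupport fun y => covectorPairL h (EuclideanSpace.proj i) (η y) (ζ y) :=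
    .intro hc fun y hy => by rw [image_eq_zero_of_notMem_tsupport hy, map_zero]
  simp only [pair_extDeriv_add_pair_extDeriv h h' (hη.differentiable one_ne_zero _)
    (hζ.differentiable one_ne_zero _)]
  rw [integral_finsetSum _ fun i _ =>
    (((hcd i).continuous_fderiv one_ne_zero).clm_apply
      continuous_const).integrable_of_hasCompactSupport ((hcs i).fderiv_apply ℝ _)]
  exact Finset.sum_eq_zero fun i _ => integral_fderiv_apply_eq_zero (hcd i) (hcs i) _

end StokesTheorem

section WeakDerivative

variable {g : Type*} [NormedAddCommGroup g] [InnerProductSpace ℝ g] {n k l : ℕ}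
  {U V : Set (Space n)} {u u' : Space n → Form n k g} {w w' : Space n → Form n (k + 1) g}

theorem bdryInt_congr (h : k + 1 + l = n) {v v' : Space n → Form n l g}
    {z z' : Space n → Form n (l + 1) g}
    (hu : u =ᵐ[volume.restrict U] u') (hw : w =ᵐ[volume.restrict U] w')
    (hv : v =ᵐ[volume.restrict U] v') (hz : z =ᵐ[volume.restrict U] z') :
    bdryInt h U u w v z = bdryInt h U u' w' v' z' := by
  refine integral_congr_ae ?_
  filter_upwards [hu, hw, hv, hz] with x hux hwx hvx hzx
  rw [hux, hwx, hvx, hzx]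

theorem bdryInt_comm (h : k + 1 + l = n) (h' : l + 1 + k = n) (U : Set (Space n))
    (u : Space n → Form n k g) (w : Space n → Form n (k + 1) g)
    (v : Space n → Form n l g) (z : Space n → Form n (l + 1) g) :
    bdryInt h U u w v z = (-1) ^ (k * l) * bdryInt h' U v z u w := by
  rw [bdryInt, bdryInt, ← integral_const_mul]
  congr 1
  ext x
  have hsign : (-1 : ℝ) ^ k * (-1) ^ (k * (l + 1)) = (-1) ^ (k * l) := by
    rw [← pow_add, show k + k * (l + 1) = k * l + 2 * k by ring, pow_add, pow_mul (-1 : ℝ) 2]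
    simp
  rw [pair_comm h (by lia) (w x) (v x), pair_comm _ h' (u x) (z x), ← mul_assoc, hsign,
    show (k + 1) * l = k * l + l by ring, pow_add]
  ring

theorem bdryInt_eq_integral (h : k + 1 + l = n) {η : Space n → Form n l g} (hη : tsupport η ⊆ U) :
    bdryInt h U u w η (extDeriv η) = bdryInt h univ u w η (extDeriv η) := by
  rw [bdryInt, bdryInt, setIntegral_univ]
  refine setIntegral_eq_integral_of_forall_compl_eq_zero fun x hx => ?_
  have hx' : x ∉ tsupport η := fun h => hx (hη h)
  rw [extDeriv_eq_zero_of_notMem_tsupport hx', image_eq_zero_of_notMem_tsupport hx',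
    ← pairL_apply, ← pairL_apply, map_zero, map_zero, mul_zero, add_zero]

theorem IsWeakD.mono (hw : IsWeakD V u w) (hUV : U ⊆ V) : IsWeakD U u w := by
  intro l h η hη hηc hηU
  rw [bdryInt_eq_integral h hηU, ← bdryInt_eq_integral h (hηU.trans hUV)]
  exact hw l h η hη hηc (hηU.trans hUV)

theorem IsWeakD.congr (hw : IsWeakD U u w) (hu : u =ᵐ[volume.restrict U] u')
    (hw' : w =ᵐ[volume.restrict U] w') : IsWeakD U u' w' := by
  intro l h η hη hηc hηU
  rw [← bdryInt_congr h hu hw' .rfl .rfl]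
  exact hw l h η hη hηc hηU

theorem isWeakD_extDeriv (U : Set (Space n)) {η : Space n → Form n k g} (hη : ContDiff ℝ 1 η) :
    IsWeakD U η (extDeriv η) := by
  intro l h ζ hζ hζc hζU
  rw [bdryInt_eq_integral h hζU, bdryInt, setIntegral_univ]
  exact integral_pair_extDeriv_add_pair_extDeriv h _ hη (hζ.of_le (by simp)) hζc

theorem isWeakD_iff_bdryInt_extDeriv_eq_zero (h : l + 1 + k = n) :
    IsWeakD U u w ↔ ∀ η : Space n → Form n l g, ContDiff ℝ ∞ η → HasCompactSupport η →
      tsupport η ⊆ U → bdryInt h U η (extDeriv η) u w = 0 := by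
  constructor
  · intro hw η hη hηc hηU
    rw [bdryInt_comm h (by lia), hw l (by lia) η hη hηc hηU, mul_zero]
  · intro hw l' h' η hη hηc hηU
    obtain rfl : l' = l := by lia
    rw [bdryInt_comm h' h, hw η hη hηc hηU, mul_zero]

theorem integrableOn_pair_test (h : k + l = n) {v : Space n → Form n l g} (hu : IntegrableOn u U)
    (hv : Continuous v) (hvc : HasCompactSupport v) :
    IntegrableOn (fun x => pair h (u x) (v x)) U := by
  obtain ⟨C, hC⟩ := hvc.exists_bound_of_continuous hv
  exact (pairL g h).integrable_of_bilin_of_bdd_right C hu hv.aestronglyMeasurable (.of_forall hC)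

theorem IsWeakD.sub (hw : IsWeakD U u w) (hw' : IsWeakD U u' w') (iu : IntegrableOn u U)
    (iu' : IntegrableOn u' U) (iw : IntegrableOn w U) (iw' : IntegrableOn w' U) :
    IsWeakD U (u - u') (w - w') := by
  intro l h η hη hηc hηU
  have hη' := continuous_extDeriv (hη.of_le (by simp))
  have hηc' := hasCompactSupport_extDeriv hηc
  have hsub := integral_sub
    ((integrableOn_pair_test h iw hη.continuous hηc).add
      ((integrableOn_pair_test (by lia) iu hη' hηc').const_mul ((-1) ^ k)))
    ((integrableOn_pair_test h iw' hη.continuous hηc).add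
      ((integrableOn_pair_test (by lia) iu' hη' hηc').const_mul ((-1) ^ k)))
  refine Eq.trans ?_ (hsub.trans ((congrArg₂ _ (hw l h η hη hηc hηU)
    (hw' l h η hη hηc hηU)).trans (sub_zero 0)))
  refine integral_congr_ae (.of_forall fun x => ?_)
  simp only [← pairL_apply, Pi.sub_apply, Pi.add_apply, map_sub, sub_apply]
  ring

theorem ae_eq_zero_of_setIntegral_bilin_smul_eq_zero {E E₁ E₂ : Type*} [NormedAddCommGroup E]
    [NormedSpace ℝ E] [FiniteDimensional ℝ E] [MeasurableSpace E] [BorelSpace E] {μ : Measure E}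
    [NormedAddCommGroup E₁] [NormedSpace ℝ E₁] [NormedAddCommGroup E₂] [NormedSpace ℝ E₂]
    (B : E₁ →L[ℝ] E₂ →L[ℝ] ℝ) {U : Set E} (hU : IsOpen U) {f : E → E₁} (hf : IntegrableOn f U μ)
    (h : ∀ ψ : E → ℝ, ContDiff ℝ ∞ ψ → HasCompactSupport ψ → tsupport ψ ⊆ U →
      ∀ b : E₂, ∫ x in U, B (f x) (ψ x • b) ∂μ = 0) : ∀ᵐ x ∂μ.restrict U, B (f x) = 0 := by
  have hBf : IntegrableOn (fun x => B (f x)) U μ := B.integrable_comp hf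
  rw [ae_restrict_iff' hU.measurableSet]
  refine hU.ae_eq_zero_of_integral_contDiff_smul_eq_zero hBf.locallyIntegrableOn
    fun ψ hψ hψc hψU => ?_
  rw [← setIntegral_eq_integral_of_forall_compl_eq_zero (s := U) fun x hx => by
    rw [image_eq_zero_of_notMem_tsupport fun h => hx (hψU h), zero_smul]]
  obtain ⟨C, hC⟩ := hψc.exists_bound_of_continuous hψ.continuous
  have hψBf : IntegrableOn (fun x => ψ x • B (f x)) U μ :=
    hBf.bdd_smul C hψ.continuous.aestronglyMeasurable (.of_forall hC)
  ext b
  rw [ContinuousLinearMap.integral_apply hψBf, zero_apply, ← h ψ hψ hψc hψU b]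
  simp

theorem IsWeakD.ae_eq_zero (h : k + 1 + l = n) (hU : IsOpen U) (hw : IsWeakD U 0 w)
    (iw : IntegrableOn w U) : w =ᵐ[volume.restrict U] 0 := by
  have hpair : ∀ᵐ x ∂volume.restrict U, pairL g h (w x) = 0 := by
    refine ae_eq_zero_of_setIntegral_bilin_smul_eq_zero (pairL g h) hU iw
      fun ψ hψ hψc hψU b => ?_
    have htest := hw l h (fun x => ψ x • b) (hψ.smul contDiff_const) hψc.smul_right
      ((tsupport_smul_subset_left ψ fun _ => b).trans hψU)
    simpa [bdryInt, ← pairL_apply] using htest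
  filter_upwards [hpair] with x hx
  exact eq_zero_of_pair_eq_zero h fun b => by rw [← pairL_apply, hx, zero_apply]

theorem IsWeakD.ae_eq (h : k + 1 + l = n) (hU : IsOpen U) (hw : IsWeakD U u w)
    (hw' : IsWeakD U u w') (iu : IntegrableOn u U) (iw : IntegrableOn w U)
    (iw' : IntegrableOn w' U) : w =ᵐ[volume.restrict U] w' := by
  have hsub := hw.sub hw' iu iu iw iw'
  rw [sub_self] at hsub
  filter_upwards [hsub.ae_eq_zero h hU (iw.sub iw')] with x hx
  exact sub_eq_zero.1 hx

theorem exists_formPair_of_contDiff (Ω : Set (Space n)) (p q : ℝ≥0∞) {η : Space n → Form n k g}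
    (hη : ContDiff ℝ 1 η) (hc : HasCompactSupport η) :
    ∃ P : FormPair g Ω k p q, P.1 =ᵐ[volume.restrict Ω] η ∧
      P.2 =ᵐ[volume.restrict Ω] extDeriv η := by
  have hLp : MemLp η p (volume.restrict Ω) := hη.continuous.memLp_of_hasCompactSupport hc
  have hLq : MemLp (extDeriv η) q (volume.restrict Ω) :=
    (continuous_extDeriv hη).memLp_of_hasCompactSupport (hasCompactSupport_extDeriv hc)
  exact ⟨(hLp.toLp η, hLq.toLp _), hLp.coeFn_toLp, hLq.coeFn_toLp⟩

end WeakDerivative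

/-! ### Triangulations -/

section Triangulation

variable {n : ℕ} {Ω K K' : Set (Space n)} {T : Geometry.SimplicialComplex ℝ (Space n)}

theorem eventually_nonpos_of_mem_interior_closure {X : Type*} [TopologicalSpace X] {S : Set X}
    {f : X → ℝ} (hf : Continuous f) {x : X} (hSf : ∀ᶠ y in 𝓝 x, y ∈ S → f y ≤ 0)
    (hx : x ∈ interior (closure S)) : ∀ᶠ y in 𝓝 x, f y ≤ 0 := by
  filter_upwards [eventually_eventually_nhds.2 hSf, isOpen_interior.mem_nhds hx] with y hy hyS
  by_contra! hpos
  obtain ⟨z, hzS, hz, hzpos⟩ := ((mem_closure_iff_frequently.1 (interior_subset hyS)).and_eventually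
    (hy.and (hf.continuousAt.eventually (lt_mem_nhds hpos)))).exists
  exact hzpos.not_ge (hz hzS)

theorem IsLipschitzDomain.interior_closure (hΩ : IsLipschitzDomain Ω) :
    interior (closure Ω) = Ω := by
  refine Subset.antisymm (fun x hx => ?_) hΩ.isOpen.subset_interior_closure
  by_contra hxΩ
  have hfr : x ∈ frontier Ω := ⟨interior_subset hx, fun h => hxΩ (interior_subset h)⟩
  obtain ⟨ν, hν, γ, C, hγ, hΩf⟩ := hΩ.boundary x hfr
  let f : Space n → ℝ := fun y => γ ((ℝ ∙ ν)ᗮ.orthogonalProjectionOnto y) - inner ℝ ν y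
  replace hΩf : ∀ᶠ y in 𝓝 x, (y ∈ Ω ↔ f y < 0) := by simpa only [f, sub_neg] using hΩf
  have hf : Continuous f := by
    have := hγ.continuous
    fun_prop
  have hshift (s : ℝ) : f (x - s • ν) = f x + s := by
    have hproj : (ℝ ∙ ν)ᗮ.orthogonalProjectionOnto (s • ν) = 0 := by
      rw [Submodule.orthogonalProjectionOnto_eq_zero_iff, Submodule.orthogonal_orthogonal]
      exact Submodule.smul_mem _ _ (Submodule.mem_span_singleton_self ν)
    simp only [f, map_sub, hproj, sub_zero, inner_sub_right, inner_smul_right,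
      real_inner_self_eq_norm_sq, hν]
    ring
  have hline : Filter.Tendsto (fun s : ℝ => x - s • ν) (𝓝[>] 0) (𝓝 x) := by
    refine tendsto_nhdsWithin_of_tendsto_nhds (Continuous.tendsto' ?_ _ _ (by simp))
    fun_prop
  obtain ⟨s, hs, hs0⟩ := ((hline.eventually (eventually_nonpos_of_mem_interior_closure hf
    (hΩf.mono fun y hy hyΩ => (hy.1 hyΩ).le) hx)).and self_mem_nhdsWithin).exists
  rw [hshift] at hs
  exact hxΩ (hΩf.self_of_nhds.2 (by linarith [show 0 < s from hs0]))

theorem volume_convexHull_eq_zero {s : Finset (Space n)} (hs : s.card ≤ n) :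
    volume (convexHull ℝ (s : Set (Space n))) = 0 := by
  classical
  rcases s.eq_empty_or_nonempty with rfl | hne
  · simp
  refine measure_mono_null (convexHull_subset_affineSpan _)
    (Measure.addHaar_affineSubspace volume _ fun htop => ?_)
  obtain ⟨c, hc⟩ := Nat.exists_eq_succ_of_ne_zero hne.card_pos.ne'
  have hrank := finrank_vectorSpan_image_finset_le ℝ (id : Space n → Space n) s hc
  rw [Finset.image_id, ← direction_affineSpan, htop, AffineSubspace.direction_top, finrank_top,
    finrank_euclideanSpace_fin] at hrank
  lia

theorem card_le_of_mem_faces {s : Finset (Space n)} (hs : s ∈ T.faces) : s.card ≤ n + 1 := by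
  have hcard := (T.indep hs).card_le_finrank_succ
  rw [Fintype.card_coe] at hcard
  have hrank := (vectorSpan ℝ (range ((↑) : s → Space n))).finrank_le
  rw [finrank_euclideanSpace_fin] at hrank
  lia

theorem IsTriangulation.isBounded (hT : IsTriangulation T Ω) : Bornology.IsBounded Ω := by
  have hspace : Bornology.IsBounded T.space :=
    (Bornology.isBounded_biUnion hT.finite).2 fun s _ =>
      isBounded_convexHull.2 s.finite_toSet.isBounded
  exact (hT.space_eq ▸ hspace).subset subset_closure

theorem IsTriangulation.isFiniteMeasure_restrict (hT : IsTriangulation T Ω) :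
    IsFiniteMeasure (volume.restrict Ω) :=
  MeasureTheory.isFiniteMeasure_restrict.2 hT.isBounded.measure_lt_top.ne

theorem IsTriangulation.finite_elements (hT : IsTriangulation T Ω) : (elements T).Finite := by
  refine (hT.finite.image fun s : Finset (Space n) => convexHull ℝ (s : Set (Space n))).subset ?_
  rintro K ⟨s, hs, -, rfl⟩
  exact mem_image_of_mem _ hs

theorem convex_of_mem_elements (hK : K ∈ elements T) : Convex ℝ K := by
  obtain ⟨s, -, -, rfl⟩ := hK
  exact convex_convexHull ℝ _

theorem restrict_interior_of_mem_elements (hK : K ∈ elements T) :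
    volume.restrict (interior K) = volume.restrict K :=
  Measure.restrict_congr_set
    (interior_ae_eq_of_null_frontier ((convex_of_mem_elements hK).addHaar_frontier volume))

theorem IsTriangulation.interior_subset (hT : IsTriangulation T Ω)
    (hΩ : interior (closure Ω) ⊆ Ω) (hK : K ∈ elements T) : interior K ⊆ Ω := by
  refine (interior_mono ?_).trans hΩ
  obtain ⟨s, hs, -, rfl⟩ := hK
  exact (T.convexHull_subset_space hs).trans hT.space_eq.subset

theorem IsTriangulation.restrict_le (hT : IsTriangulation T Ω)
    (hΩ : interior (closure Ω) ⊆ Ω) (hK : K ∈ elements T) :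
    volume.restrict K ≤ volume.restrict Ω := by
  rw [← restrict_interior_of_mem_elements hK]
  exact Measure.restrict_mono (hT.interior_subset hΩ hK) le_rfl

theorem disjoint_interior_of_mem_elements (hK : K ∈ elements T) (hK' : K' ∈ elements T)
    (hne : K ≠ K') : Disjoint (interior K) (interior K') := by
  classical
  obtain ⟨s, hs, hsn, rfl⟩ := hK
  obtain ⟨t, ht, htn, rfl⟩ := hK'
  have hst : ¬ s ⊆ t := fun h => hne (by rw [Finset.eq_of_subset_of_card_le h (by lia)])
  have hcard : (s ∩ t).card ≤ n := by
    rw [← Nat.lt_add_one_iff, ← hsn]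
    exact Finset.card_lt_card
      ⟨Finset.inter_subset_left, fun h => hst (Finset.subset_inter_iff.1 h).2⟩
  have hnull := volume_convexHull_eq_zero hcard
  rw [Finset.coe_inter] at hnull
  rw [disjoint_iff_inter_eq_empty]
  exact ((isOpen_interior.inter isOpen_interior).measure_eq_zero_iff volume).1 (measure_mono_null
    ((inter_subset_inter interior_subset interior_subset).trans
      (T.inter_subset_convexHull hs ht)) hnull)

theorem IsTriangulation.subset_biUnion (hT : IsTriangulation T Ω) :
    Ω ⊆ (⋃ K ∈ elements T, K) ∪
      ⋃ s ∈ {s ∈ T.faces | s.card ≤ n}, convexHull ℝ (s : Set (Space n)) := by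
  intro x hx
  obtain ⟨s, hs, hxs⟩ := T.mem_space_iff.1 (hT.space_eq ▸ subset_closure hx)
  rcases (card_le_of_mem_faces hs).lt_or_eq with hlt | heq
  · exact .inr (mem_biUnion ⟨hs, Nat.le_of_lt_succ hlt⟩ hxs)
  · exact .inl (mem_biUnion ⟨s, hs, heq, rfl⟩ hxs)

theorem IsTriangulation.biUnion_interior_ae_eq (hT : IsTriangulation T Ω)
    (hΩ : interior (closure Ω) ⊆ Ω) : (⋃ K ∈ elements T, interior K : Set _) =ᵐ[volume] Ω := by
  have hfaces :
      volume (⋃ s ∈ {s ∈ T.faces | s.card ≤ n}, convexHull ℝ (s : Set (Space n))) = 0 :=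
    (measure_biUnion_null_iff (hT.finite.subset fun _ hs => hs.1).countable).2 fun _ hs =>
      volume_convexHull_eq_zero hs.2
  have hinterior : (⋃ K ∈ elements T, interior K : Set _) =ᵐ[volume] ⋃ K ∈ elements T, K :=
    .countable_bUnion hT.finite_elements.countable fun K hK =>
      interior_ae_eq_of_null_frontier ((convex_of_mem_elements hK).addHaar_frontier volume)
  have hcover : (Ω : Set _) ≤ᵐ[volume] ⋃ K ∈ elements T, K :=
    hT.subset_biUnion.eventuallyLE.trans (union_ae_eq_left_of_ae_eq_empty (ae_eq_empty.2 hfaces)).le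
  have hsubset : (⋃ K ∈ elements T, interior K) ⊆ Ω :=
    iUnion₂_subset fun K hK => hT.interior_subset hΩ hK
  exact hsubset.eventuallyLE.antisymm (hcover.trans hinterior.symm.le)

theorem IsTriangulation.finsum_setIntegral (hT : IsTriangulation T Ω)
    (hΩ : interior (closure Ω) ⊆ Ω) {E : Type*} [NormedAddCommGroup E] [NormedSpace ℝ E]
    {f : Space n → E} (hf : IntegrableOn f Ω) :
    ∑ᶠ K ∈ elements T, ∫ x in K, f x = ∫ x in Ω, f x := by
  have hmem (K) : K ∈ hT.finite_elements.toFinset ↔ K ∈ elements T :=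
    hT.finite_elements.mem_toFinset
  have hunion : (⋃ K ∈ elements T, interior K) =
      ⋃ K ∈ hT.finite_elements.toFinset, interior K := by simp only [hmem]
  rw [← setIntegral_congr_set (hT.biUnion_interior_ae_eq hΩ), hunion,
    finsum_mem_eq_finite_toFinset_sum _ hT.finite_elements,
    integral_biUnion_finset _ (fun K _ => isOpen_interior.measurableSet)
      (fun K hK K' hK' =>
        disjoint_interior_of_mem_elements ((hmem K).1 hK) ((hmem K').1 hK'))
      (fun K hK => hf.mono_set (hT.interior_subset hΩ ((hmem K).1 hK)))]
  exact Finset.sum_congr rfl fun K hK => by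
    rw [restrict_interior_of_mem_elements ((hmem K).1 hK)]

end Triangulation

/-! ### Boundary pairings on a triangulated domain -/

section Decomposition

variable {g : Type*} [NormedAddCommGroup g] [InnerProductSpace ℝ g] {n k l : ℕ}
  {p q p' q' : ℝ≥0∞} {Ω K : Set (Space n)} {T : Geometry.SimplicialComplex ℝ (Space n)}
  {v v' : Space n → Form n l g} {z z' : Space n → Form n (l + 1) g}

/-- The forms in `Conf g Ω k p q` with vanishing tangential trace on `∂Ω`, where the trace is the
functional given by the boundary pairing on `Conf g Ω l p' q'`.  The spaces `V0ring` and `V1ring`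
are instances, up to definitional unfolding. -/
def ConfZero (g : Type*) [NormedAddCommGroup g] [InnerProductSpace ℝ g] (h : k + 1 + l = n)
    (Ω : Set (Space n)) (p q p' q' : ℝ≥0∞) : Set (FormPair g Ω k p q) :=
  {P ∈ Conf g Ω k p q | ∀ Q ∈ Conf g Ω l p' q', bdryInt h Ω P.1 P.2 Q.1 Q.2 = 0}

theorem mem_confZero_iff (h : k + 1 + l = n) {P : FormPair g Ω k p q} :
    P ∈ ConfZero g h Ω p q p' q' ↔
      ∀ Q ∈ Conf g Ω l p' q', bdryInt h Ω P.1 P.2 Q.1 Q.2 = 0 := by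
  refine ⟨And.right, fun hP => ⟨fun l' h' η hη hηc _ => ?_, hP⟩⟩
  obtain rfl : l' = l := by lia
  obtain ⟨Q, hQη, hQdη⟩ := exists_formPair_of_contDiff Ω p' q' (hη.of_le (by simp)) hηc
  rw [← bdryInt_congr h' .rfl .rfl hQη hQdη]
  exact hP Q ((isWeakD_extDeriv Ω (hη.of_le (by simp))).congr hQη.symm hQdη.symm)

theorem isWeakD_of_forall_mem_confZero (h : k + 1 + l = n)
    (hvz : ∀ P ∈ ConfZero g h Ω p q p' q', bdryInt h Ω P.1 P.2 v z = 0) : IsWeakD Ω v z := by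
  rw [isWeakD_iff_bdryInt_extDeriv_eq_zero h]
  intro η hη hηc hηΩ
  obtain ⟨P, hPη, hPdη⟩ := exists_formPair_of_contDiff Ω p q (hη.of_le (by simp)) hηc
  rw [← bdryInt_congr h hPη hPdη .rfl .rfl]
  refine hvz P ((mem_confZero_iff h).2 fun Q hQ => ?_)
  rw [bdryInt_congr h hPη hPdη .rfl .rfl]
  exact (isWeakD_iff_bdryInt_extDeriv_eq_zero h).1 hQ η hη hηc hηΩ

theorem hasTangentialTrace_iff (h : k + 1 + l = n)
    (hK : volume.restrict (interior K) = volume.restrict K) [IsFiniteMeasure (volume.restrict K)]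
    (hp' : 1 ≤ p') (hq' : 1 ≤ q') (hv : MemLp v p' (volume.restrict K))
    (hz : MemLp z q' (volume.restrict K)) (hvz : IsWeakD (interior K) v z)
    {S : Set (FormPair g Ω k p q)} {τ : S → ℝ} :
    HasTangentialTrace h S K p' q' v τ ↔ ∀ P : S, τ P = bdryInt h K P.1.1 P.1.2 v z := by
  refine ⟨?_, fun hτ => ⟨hv, z, hz, hvz, hτ⟩⟩
  rintro ⟨-, y, hy, hvy, hτ⟩ P
  have hyz : y =ᵐ[volume.restrict K] z := by
    have hfin : IsFiniteMeasure (volume.restrict (interior K)) := hK ▸ inferInstance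
    rw [← hK] at hv hz hy ⊢
    exact hvy.ae_eq (by lia : l + 1 + k = n) isOpen_interior hvz (hv.integrable hp')
      (hy.integrable hq') (hz.integrable hq')
  rw [hτ P, bdryInt_congr h .rfl .rfl .rfl hyz]

theorem conf_subset_broken (hT : IsTriangulation T Ω) (hΩ : interior (closure Ω) ⊆ Ω) :
    Conf g Ω k p q ⊆ Broken g Ω T k p q :=
  fun _ hP _ hK => IsWeakD.mono hP (hT.interior_subset hΩ hK)

theorem IsWeakD.sameTrace_iff (hT : IsTriangulation T Ω) (hΩ : interior (closure Ω) ⊆ Ω)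
    (hK : K ∈ elements T) (h : k + 1 + l = n) (hp' : 1 ≤ p') (hq' : 1 ≤ q')
    (hv : MemLp v p' (volume.restrict Ω)) (hz : MemLp z q' (volume.restrict Ω))
    (hvz : IsWeakD Ω v z) (hv' : MemLp v' p' (volume.restrict Ω))
    (hz' : MemLp z' q' (volume.restrict Ω)) (hvz' : IsWeakD Ω v' z')
    {S : Set (FormPair g Ω k p q)} :
    SameTrace h S K p' q' v v' ↔
      ∀ P ∈ S, bdryInt h K P.1 P.2 v z = bdryInt h K P.1 P.2 v' z' := by
  have hfin := hT.isFiniteMeasure_restrict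
  have hle := hT.restrict_le hΩ hK
  have hfinK : IsFiniteMeasure (volume.restrict K) := isFiniteMeasure_of_le _ hle
  have hKΩ := hT.interior_subset hΩ hK
  have hinterior := restrict_interior_of_mem_elements hK
  simp only [SameTrace, hasTangentialTrace_iff h hinterior hp' hq' (hv.mono_measure hle)
    (hz.mono_measure hle) (hvz.mono hKΩ), hasTangentialTrace_iff h hinterior hp' hq'
    (hv'.mono_measure hle) (hz'.mono_measure hle) (hvz'.mono hKΩ)]
  exact ⟨fun ⟨τ, hτ, hτ'⟩ P hP => (hτ ⟨P, hP⟩).symm.trans (hτ' ⟨P, hP⟩),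
    fun heq => ⟨_, fun _ => rfl, fun P => heq P P.2⟩⟩

theorem exists_mem_conf_forall_bdryInt_eq (hT : IsTriangulation T Ω)
    (hΩ : interior (closure Ω) ⊆ Ω) (h : k + 1 + l = n) (hv : MemLp v p' (volume.restrict Ω))
    (hz : MemLp z q' (volume.restrict Ω)) (hvz : IsWeakD Ω v z) :
    ∃ Q ∈ Conf g Ω l p' q', ∀ K ∈ elements T, ∀ P : FormPair g Ω k p q,
      bdryInt h K P.1 P.2 Q.1 Q.2 = bdryInt h K P.1 P.2 v z := by
  refine ⟨(hv.toLp v, hz.toLp z), hvz.congr hv.coeFn_toLp.symm hz.coeFn_toLp.symm,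
    fun K hK P => ?_⟩
  have hae := ae_mono (hT.restrict_le hΩ hK)
  exact bdryInt_congr h .rfl .rfl (hae hv.coeFn_toLp) (hae hz.coeFn_toLp)

variable [ENNReal.HolderTriple p q' 1] [ENNReal.HolderTriple q p' 1]

theorem finsum_bdryInt (hT : IsTriangulation T Ω) (hΩ : interior (closure Ω) ⊆ Ω)
    (h : k + 1 + l = n) (P : FormPair g Ω k p q) (hv : MemLp v p' (volume.restrict Ω))
    (hz : MemLp z q' (volume.restrict Ω)) :
    ∑ᶠ K ∈ elements T, bdryInt h K P.1 P.2 v z = bdryInt h Ω P.1 P.2 v z := by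
  have hleft := memLp_one_iff_integrable.1 ((pairL g h).memLp_of_bilin 1 (Lp.memLp P.2) hv)
  have hright := memLp_one_iff_integrable.1
    ((pairL g (by lia : k + (l + 1) = n)).memLp_of_bilin 1 (Lp.memLp P.1) hz)
  exact hT.finsum_setIntegral hΩ (hleft.add (hright.const_mul _))

theorem mem_confZero_iff_finsum (hT : IsTriangulation T Ω) (hΩ : interior (closure Ω) ⊆ Ω)
    (h : k + 1 + l = n) {P : FormPair g Ω k p q} :
    P ∈ ConfZero g h Ω p q p' q' ↔
      ∀ Q ∈ Conf g Ω l p' q', ∑ᶠ K ∈ elements T, bdryInt h K P.1 P.2 Q.1 Q.2 = 0 := by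
  rw [mem_confZero_iff]
  refine forall₂_congr fun Q _ => ?_
  rw [finsum_bdryInt hT hΩ h P (Lp.memLp Q.1) (Lp.memLp Q.2)]

theorem bdryInt_eq_zero_of_mem_confZero (hT : IsTriangulation T Ω)
    (hΩ : interior (closure Ω) ⊆ Ω) (h : k + 1 + l = n) {Q : FormPair g Ω l p' q'}
    (hQ : Q ∈ Conf g Ω l p' q') (hv : MemLp v p' (volume.restrict Ω))
    (hz : MemLp z q' (volume.restrict Ω))
    (heq : ∀ K ∈ elements T, ∀ P ∈ Broken g Ω T k p q,
      bdryInt h K P.1 P.2 Q.1 Q.2 = bdryInt h K P.1 P.2 v z)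
    {P : FormPair g Ω k p q} (hP : P ∈ ConfZero g h Ω p q p' q') :
    bdryInt h Ω P.1 P.2 v z = 0 :=
  calc bdryInt h Ω P.1 P.2 v z
    _ = ∑ᶠ K ∈ elements T, bdryInt h K P.1 P.2 v z := (finsum_bdryInt hT hΩ h P hv hz).symm
    _ = ∑ᶠ K ∈ elements T, bdryInt h K P.1 P.2 Q.1 Q.2 :=
      finsum_mem_congr rfl fun K hK => (heq K hK P (conf_subset_broken hT hΩ hP.1)).symm
    _ = 0 := (mem_confZero_iff_finsum hT hΩ h).1 hP Q hQ

end Decomposition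

/-! ### Fields and solutions -/

section Exponents

theorem inv_fourThirds : (4 / 3 : ℝ≥0∞)⁻¹ = 3 / 4 := ENNReal.inv_div (by simp) (by simp)

theorem one_le_fourThirds : (1 : ℝ≥0∞) ≤ 4 / 3 := by
  rw [ENNReal.le_div_iff_mul_le (by simp) (by simp)]
  norm_num

theorem fourThirds_le_four : (4 / 3 : ℝ≥0∞) ≤ 4 :=
  ENNReal.div_le_of_le_mul (le_mul_of_one_le_right' (by norm_num))

instance holderTriple_four_fourThirds_one : ENNReal.HolderTriple 4 (4 / 3) 1 := ⟨by
  rw [inv_fourThirds, ← one_div, ENNReal.div_add_div_same, inv_one,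
    ENNReal.div_eq_one_iff (by simp) (by simp)]
  norm_num⟩

instance holderTriple_four_four_two : ENNReal.HolderTriple 4 4 2 := ⟨by
  rw [← one_div, ← one_div, ENNReal.div_add_div_same,
    ENNReal.div_eq_div_iff (by simp) (by simp) (by simp) (by simp)]
  norm_num⟩

instance holderTriple_four_two_fourThirds : ENNReal.HolderTriple 4 2 (4 / 3) := ⟨by
  rw [← ENNReal.HolderTriple.inv_add_inv_eq_inv 4 4 2, inv_fourThirds, ← one_div,
    ENNReal.div_add_div_same, ENNReal.div_add_div_same]
  norm_num⟩

end Exponents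

section Integrability

theorem memLp_clm_apply {α E F : Type*} [MeasurableSpace α] {μ : Measure α}
    [NormedAddCommGroup E] [NormedSpace ℝ E] [NormedAddCommGroup F] [NormedSpace ℝ F]
    {p q r : ℝ≥0∞} [ENNReal.HolderTriple p q r] {κ : α → E →L[ℝ] F} {u : α → E}
    (hκ : MemLp κ p μ) (hu : MemLp u q μ) : MemLp (fun x => κ x (u x)) r μ :=
  (ContinuousLinearMap.id ℝ (E →L[ℝ] F)).memLp_of_bilin r hκ hu

theorem memLp_compContinuousAlternatingMap {α E F F' ι : Type*} [MeasurableSpace α]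
    {μ : Measure α} [Fintype ι] [NormedAddCommGroup E] [NormedSpace ℝ E] [NormedAddCommGroup F]
    [NormedSpace ℝ F] [NormedAddCommGroup F'] [NormedSpace ℝ F'] {p : ℝ≥0∞} (L : F →L[ℝ] F')
    {u : α → E [⋀^ι]→L[ℝ] F} (hu : MemLp u p μ) :
    MemLp (fun x => L.compContinuousAlternatingMap (u x)) p μ :=
  (ContinuousLinearMap.compContinuousAlternatingMapCLM ℝ E F F' (ι := ι) L).comp_memLp' hu

theorem memLp_extendCoeff {α g : Type*} [MeasurableSpace α] {μ : Measure α}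
    [NormedAddCommGroup g] [InnerProductSpace ℝ g] [FiniteDimensional ℝ g] {n k l : ℕ}
    {p q r : ℝ≥0∞} [ENNReal.HolderTriple p q r] {κ : α → Form n k ℝ →L[ℝ] Form n l ℝ}
    {u : α → Form n k g} (hκ : MemLp κ p μ) (hu : MemLp u q μ) :
    MemLp (fun x => extendCoeff (κ x) (u x)) r μ :=
  memLp_finsetSum (ε' := Form n l g) _ fun _ _ => memLp_compContinuousAlternatingMap _
    (memLp_clm_apply hκ (memLp_compContinuousAlternatingMap _ hu))

theorem memLp_brk {α g : Type*} [MeasurableSpace α] {μ : Measure α} [NormedLieRing g]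
    [InvariantLieAlgebra g] [FiniteDimensional ℝ g] {n k l j : ℕ} (h : k + l = j) {p q r : ℝ≥0∞}
    [ENNReal.HolderTriple p q r] {u : α → Form n k g} {v : α → Form n l g} (hu : MemLp u p μ)
    (hv : MemLp v q μ) : MemLp (fun x => brk h (u x) (v x)) r μ :=
  (wedgeL n (bracketL g) h).memLp_of_bilin r hu hv

end Integrability

section Solutions

variable {g : Type*} [NormedLieRing g] [InvariantLieAlgebra g] [FiniteDimensional ℝ g] {m : ℕ}
  {Ω : Set (Space (m + 2))} {T : Geometry.SimplicialComplex ℝ (Space (m + 2))} {I : Set ℝ}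
  {μinv : Space (m + 2) → Form (m + 2) 2 ℝ →L[ℝ] Form (m + 2) m ℝ}
  {A : ℝ → FormPair g Ω 1 4 2} {φ : ℝ → FormPair g Ω 0 ⊤ 4} {D : ℝ → LpForm g Ω (m + 1) 4}
  {ρ : ℝ → LpForm g Ω (m + 2) 1}

/-- The exterior derivative of `H` prescribed by the Yang–Mills equation `d_A H = Ḋ - [φ, D]`. -/
def derivH (I : Set ℝ) (μinv : Space (m + 2) → Form (m + 2) 2 ℝ →L[ℝ] Form (m + 2) m ℝ)
    (A : ℝ → FormPair g Ω 1 4 2) (φ : ℝ → FormPair g Ω 0 ⊤ 4) (D : ℝ → LpForm g Ω (m + 1) 4)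
    (t : ℝ) (x : Space (m + 2)) : Form (m + 2) (m + 1) g :=
  derivWithin D I t x - brk (by omega) ((φ t).1 x) (D t x) -
    brk (by omega) ((A t).1 x) (magneticField μinv A t x)

/-- The exterior derivative of `D` prescribed by the Yang–Mills equation `d_A D = ρ`. -/
def derivD (A : ℝ → FormPair g Ω 1 4 2) (D : ℝ → LpForm g Ω (m + 1) 4)
    (ρ : ℝ → LpForm g Ω (m + 2) 1) (t : ℝ) (x : Space (m + 2)) : Form (m + 2) (m + 2) g :=
  ρ t x - brk (by omega) ((A t).1 x) (D t x)

theorem memLp_magneticField (hμ : MemLp μinv ⊤ (volume.restrict Ω)) (A : ℝ → FormPair g Ω 1 4 2)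
    (t : ℝ) : MemLp (magneticField μinv A t) 2 (volume.restrict Ω) := by
  have hAA : MemLp (fun x => brk (by lia : 1 + 1 = 2) ((A t).1 x) ((A t).1 x)) 2
      (volume.restrict Ω) := memLp_brk _ (Lp.memLp (A t).1) (Lp.memLp (A t).1)
  exact memLp_extendCoeff hμ ((Lp.memLp (A t).2).add (hAA.const_smul (1 / 2 : ℝ)))

theorem memLp_derivH [IsFiniteMeasure (volume.restrict Ω)] (I : Set ℝ)
    (hμ : MemLp μinv ⊤ (volume.restrict Ω)) (A : ℝ → FormPair g Ω 1 4 2)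
    (φ : ℝ → FormPair g Ω 0 ⊤ 4) (D : ℝ → LpForm g Ω (m + 1) 4) (t : ℝ) :
    MemLp (derivH I μinv A φ D t) (4 / 3) (volume.restrict Ω) := by
  have hφD : MemLp (fun x => brk (by lia : 0 + (m + 1) = m + 1) ((φ t).1 x) (D t x)) 4
      (volume.restrict Ω) := memLp_brk _ (Lp.memLp (φ t).1) (Lp.memLp (D t))
  have hAH : MemLp (fun x => brk (by lia : 1 + m = m + 1) ((A t).1 x) (magneticField μinv A t x))
      (4 / 3) (volume.restrict Ω) := memLp_brk _ (Lp.memLp (A t).1) (memLp_magneticField hμ A t)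
  exact (((Lp.memLp (derivWithin D I t)).sub hφD).mono_exponent fourThirds_le_four).sub hAH

theorem memLp_derivD [IsFiniteMeasure (volume.restrict Ω)] (A : ℝ → FormPair g Ω 1 4 2)
    (D : ℝ → LpForm g Ω (m + 1) 4) (ρ : ℝ → LpForm g Ω (m + 2) 1) (t : ℝ) :
    MemLp (derivD A D ρ t) 1 (volume.restrict Ω) := by
  have hAD : MemLp (fun x => brk (by lia : 1 + (m + 1) = m + 2) ((A t).1 x) (D t x)) 2
      (volume.restrict Ω) := memLp_brk _ (Lp.memLp (A t).1) (Lp.memLp (D t))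
  exact (Lp.memLp (ρ t)).sub (hAD.mono_exponent (by norm_num))

theorem pair_covD {n k l : ℕ} (h : k + 1 + l = n) (h' : k + (l + 1) = n) (hl : 1 + l = l + 1)
    (a : Form n 1 g) (u : Form n k g) (w : Form n (k + 1) g) (v : Form n l g) :
    pair h (covD a u w) v = pair h w v - (-1) ^ k * pair h' u (brk hl a v) := by
  rw [covD, brk_comm (by lia) rfl a u, one_mul, ← pair_brk rfl h hl h']
  simp only [← pairL_apply, map_add, map_neg, map_smul, _root_.add_apply, _root_.neg_apply,
    smul_apply, smul_eq_mul, sub_eq_add_neg]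

theorem formA_eq_neg_bdryInt (U : Set (Space (m + 2))) (I : Set ℝ)
    (μinv : Space (m + 2) → Form (m + 2) 2 ℝ →L[ℝ] Form (m + 2) m ℝ)
    (A : ℝ → FormPair g Ω 1 4 2) (φ : ℝ → FormPair g Ω 0 ⊤ 4) (D : ℝ → LpForm g Ω (m + 1) 4)
    (t : ℝ) (A' : FormPair g Ω 1 4 2) :
    formA U I μinv A φ D t A' =
      -bdryInt (by omega) U A'.1 A'.2 (magneticField μinv A t) (derivH I μinv A φ D t) := by
  rw [formA, bdryInt, ← integral_neg]
  refine integral_congr_ae (.of_forall fun x => ?_)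
  beta_reduce
  rw [pair_covD (by lia) (by lia) (by lia), derivH]
  simp only [← pairL_apply, map_sub]
  ring

theorem formφ_eq_bdryInt (U : Set (Space (m + 2))) (A : ℝ → FormPair g Ω 1 4 2)
    (D : ℝ → LpForm g Ω (m + 1) 4) (ρ : ℝ → LpForm g Ω (m + 2) 1) (t : ℝ)
    (φ' : FormPair g Ω 0 ⊤ 4) :
    formφ U A D ρ t φ' = bdryInt (by omega) U φ'.1 φ'.2 (D t) (derivD A D ρ t) := by
  rw [formφ, bdryInt]
  refine integral_congr_ae (.of_forall fun x => ?_)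
  beta_reduce
  rw [pair_covD (by lia) (by lia) (by lia), derivD]
  simp only [← pairL_apply, map_sub]
  ring

theorem formA_add_bdryInt_eq_zero_iff {K : Set (Space (m + 2))} {t : ℝ}
    {A' : FormPair g Ω 1 4 2} {H' : FormPair g Ω m 2 (4 / 3)} :
    formA K I μinv A φ D t A' + bdryInt (by omega) K A'.1 A'.2 H'.1 H'.2 = 0 ↔
      bdryInt (by omega) K A'.1 A'.2 H'.1 H'.2 =
        bdryInt (by omega) K A'.1 A'.2 (magneticField μinv A t) (derivH I μinv A φ D t) := by
  rw [formA_eq_neg_bdryInt, neg_add_eq_zero, eq_comm]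

theorem formφ_sub_bdryInt_eq_zero_iff {K : Set (Space (m + 2))} {t : ℝ}
    {φ' : FormPair g Ω 0 ⊤ 4} {D' : FormPair g Ω (m + 1) (4 / 3) 1} :
    formφ K A D ρ t φ' - bdryInt (by omega) K φ'.1 φ'.2 D'.1 D'.2 = 0 ↔
      bdryInt (by omega) K φ'.1 φ'.2 D'.1 D'.2 =
        bdryInt (by omega) K φ'.1 φ'.2 (D t) (derivD A D ρ t) := by
  rw [formφ_eq_bdryInt, sub_eq_zero, eq_comm]

theorem SolvesYM.isWeakD_magneticField (hs : SolvesYM I μinv A φ D ρ) {t : ℝ} (ht : t ∈ I) :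
    IsWeakD Ω (magneticField μinv A t) (derivH I μinv A φ D t) := by
  refine isWeakD_of_forall_mem_confZero (p := 4) (q := 2) (p' := 2) (q' := 4 / 3)
    (by lia : 1 + 1 + m = m + 2) fun A' hA' => ?_
  rw [← neg_eq_zero, ← formA_eq_neg_bdryInt, hs.eq_A t ht A' hA']

theorem SolvesYM.isWeakD_displacement (hs : SolvesYM I μinv A φ D ρ) {t : ℝ} (ht : t ∈ I) :
    IsWeakD Ω (D t) (derivD A D ρ t) := by
  refine isWeakD_of_forall_mem_confZero (p := ⊤) (q := 4) (p' := 4 / 3) (q' := 1)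
    (by lia : 0 + 1 + (m + 1) = m + 2) fun φ' hφ' => ?_
  rw [← formφ_eq_bdryInt, hs.eq_φ t ht φ' hφ']

theorem solvesDD_iff (hT : IsTriangulation T Ω) (hΩ : interior (closure Ω) ⊆ Ω)
    (hμ : MemLp μinv ⊤ (volume.restrict Ω)) {Hhat : ℝ → FormPair g Ω m 2 (4 / 3)}
    {Dhat : ℝ → FormPair g Ω (m + 1) (4 / 3) 1} (hH : ∀ t ∈ I, Hhat t ∈ VhatH g Ω)
    (hD : ∀ t ∈ I, Dhat t ∈ VhatD g Ω) :
    SolvesDD T I μinv A φ D ρ Hhat Dhat ↔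
      SolvesYM I μinv A φ D ρ ∧ ∀ t ∈ I, ∀ K ∈ elements T,
        (∀ A' ∈ DV1 g Ω T, bdryInt (by omega) K A'.1 A'.2 (Hhat t).1 (Hhat t).2 =
          bdryInt (by omega) K A'.1 A'.2 (magneticField μinv A t) (derivH I μinv A φ D t)) ∧
        ∀ φ' ∈ DV0 g Ω T, bdryInt (by omega) K φ'.1 φ'.2 (Dhat t).1 (Dhat t).2 =
          bdryInt (by omega) K φ'.1 φ'.2 (D t) (derivD A D ρ t) := by
  have hfin := hT.isFiniteMeasure_restrict
  refine ⟨fun hs => ?_, fun ⟨hs, htr⟩ => ?_⟩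
  · have htrH := fun t ht K hK A' hA' =>
      formA_add_bdryInt_eq_zero_iff.1 (hs.eq_A t ht K hK A' hA')
    have htrD := fun t ht K hK φ' hφ' =>
      formφ_sub_bdryInt_eq_zero_iff.1 (hs.eq_φ t ht K hK φ' hφ')
    refine ⟨⟨hs.contDiffOn_A, fun t ht => ?_, hs.continuousOn_φ, fun t ht => ?_,
      fun t ht A' hA' => ?_, fun t ht φ' hφ' => ?_⟩,
      fun t ht K hK => ⟨htrH t ht K hK, htrD t ht K hK⟩⟩
    · exact (mem_confZero_iff_finsum hT hΩ _).2 (hs.continuity_A t ht)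
    · exact (mem_confZero_iff_finsum hT hΩ _).2 (hs.continuity_φ t ht)
    · rw [formA_eq_neg_bdryInt, neg_eq_zero]
      exact bdryInt_eq_zero_of_mem_confZero hT hΩ _ (hH t ht) (memLp_magneticField hμ A t)
        (memLp_derivH I hμ A φ D t) (htrH t ht) hA'
    · rw [formφ_eq_bdryInt]
      exact bdryInt_eq_zero_of_mem_confZero hT hΩ _ (hD t ht)
        ((Lp.memLp (D t)).mono_exponent fourThirds_le_four) (memLp_derivD A D ρ t) (htrD t ht) hφ'
  · exact ⟨hs.contDiffOn_A, fun t ht => conf_subset_broken hT hΩ (hs.mem_A t ht).1,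
      hs.continuousOn_φ, fun t ht => conf_subset_broken hT hΩ (hs.mem_φ t ht).1, hH, hD,
      fun t ht K hK A' hA' => formA_add_bdryInt_eq_zero_iff.2 ((htr t ht K hK).1 A' hA'),
      fun t ht K hK φ' hφ' => formφ_sub_bdryInt_eq_zero_iff.2 ((htr t ht K hK).2 φ' hφ'),
      fun t ht => (mem_confZero_iff_finsum hT hΩ _).1 (hs.mem_A t ht),
      fun t ht => (mem_confZero_iff_finsum hT hΩ _).1 (hs.mem_φ t ht)⟩

end Solutions

end YM

end

theorem mainTheorem3_general {g : Type*} [YM.NormedLieRing g] [YM.InvariantLieAlgebra g]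
    [FiniteDimensional ℝ g] {m : ℕ} {Ω : Set (YM.Space (m + 2))} (hΩ : interior (closure Ω) = Ω)
    (T : Geometry.SimplicialComplex ℝ (YM.Space (m + 2))) (hT : YM.IsTriangulation T Ω)
    (μinv : YM.Space (m + 2) → YM.Form (m + 2) 2 ℝ →L[ℝ] YM.Form (m + 2) m ℝ)
    (hμ : MemLp μinv ⊤ (volume.restrict Ω)) (I : Set ℝ) (hI : UniqueDiffOn ℝ I)
    (A : ℝ → YM.FormPair g Ω 1 4 2) (φ : ℝ → YM.FormPair g Ω 0 ⊤ 4)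
    (D : ℝ → YM.LpForm g Ω (m + 1) 4) (hD : DifferentiableOn ℝ D I)
    (ρ : ℝ → YM.LpForm g Ω (m + 2) 1) :
    (∀ (Hhat : ℝ → YM.FormPair g Ω m 2 (4 / 3)) (Dhat : ℝ → YM.FormPair g Ω (m + 1) (4 / 3) 1),
      (∀ t ∈ I, Hhat t ∈ YM.VhatH g Ω) → (∀ t ∈ I, Dhat t ∈ YM.VhatD g Ω) →
      (YM.SolvesDD T I μinv A φ D ρ Hhat Dhat ↔
        YM.SolvesYM I μinv A φ D ρ ∧
        ∀ t ∈ I, ∀ K ∈ YM.elements T,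
          YM.SameTrace (by omega) (YM.DV1 g Ω T) K 2 (4 / 3)
            ((Hhat t).1) (YM.magneticField μinv A t) ∧
          YM.SameTrace (by omega) (YM.DV0 g Ω T) K (4 / 3) 1
            ((Dhat t).1) (D t))) ∧
    (YM.SolvesYM I μinv A φ D ρ →
      ∃ (Hhat : ℝ → YM.FormPair g Ω m 2 (4 / 3)) (Dhat : ℝ → YM.FormPair g Ω (m + 1) (4 / 3) 1),
        YM.SolvesDD T I μinv A φ D ρ Hhat Dhat) := by
  have hfin := hT.isFiniteMeasure_restrict
  have hH (t : ℝ) := YM.memLp_magneticField hμ A t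
  have hdH (t : ℝ) := YM.memLp_derivH I hμ A φ D t
  have hD43 (t : ℝ) := (Lp.memLp (D t)).mono_exponent YM.fourThirds_le_four
  have hdD (t : ℝ) := YM.memLp_derivD A D ρ t
  refine ⟨fun Hhat Dhat hHhat hDhat => ?_, fun hs => ?_⟩
  · rw [YM.solvesDD_iff hT hΩ.le hμ hHhat hDhat]
    refine and_congr_right fun hs => forall₄_congr fun t ht K hK => ?_
    rw [YM.IsWeakD.sameTrace_iff hT hΩ.le hK _ (by norm_num) YM.one_le_fourThirds
        (Lp.memLp _) (Lp.memLp _) (hHhat t ht) (hH t) (hdH t) (hs.isWeakD_magneticField ht),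
      YM.IsWeakD.sameTrace_iff hT hΩ.le hK _ YM.one_le_fourThirds le_rfl
        (Lp.memLp _) (Lp.memLp _) (hDhat t ht) (hD43 t) (hdD t) (hs.isWeakD_displacement ht)]
  · choose! Hhat hHhat htrH using fun t ht => YM.exists_mem_conf_forall_bdryInt_eq hT hΩ.le
      (by omega : 1 + 1 + m = m + 2) (p := 4) (q := 2) (hH t) (hdH t) (hs.isWeakD_magneticField ht)
    choose! Dhat hDhat htrD using fun t ht => YM.exists_mem_conf_forall_bdryInt_eq hT hΩ.le
      (by omega : 0 + 1 + (m + 1) = m + 2) (p := ⊤) (q := 4) (hD43 t) (hdD t)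
      (hs.isWeakD_displacement ht)
    exact ⟨Hhat, Dhat, (YM.solvesDD_iff hT hΩ.le hμ hHhat hDhat).2 ⟨hs, fun t ht K hK =>
      ⟨fun A' _ => htrH t ht K hK A', fun φ' _ => htrD t ht K hK φ'⟩⟩⟩

theorem mainTheorem3 {g : Type*} [YM.NormedLieRing g] [YM.InvariantLieAlgebra g]
    [FiniteDimensional ℝ g] {m : ℕ} {Ω : Set (YM.Space (m + 2))}
    (hΩ : YM.IsLipschitzDomain Ω) (hbdd : Bornology.IsBounded Ω)
    (T : Geometry.SimplicialComplex ℝ (YM.Space (m + 2))) (hT : YM.IsTriangulation T Ω)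
    (ε : YM.Space (m + 2) → YM.Form (m + 2) 1 ℝ →L[ℝ] YM.Form (m + 2) (m + 1) ℝ)
    (hε : YM.IsMaterialTensor (by omega) Ω ε)
    (μinv : YM.Space (m + 2) → YM.Form (m + 2) 2 ℝ →L[ℝ] YM.Form (m + 2) m ℝ)
    (hμ : YM.IsMaterialTensor (by omega) Ω μinv)
    (I : Set ℝ) (hI : I.OrdConnected) (hI' : I.Nontrivial)
    (A : ℝ → YM.FormPair g Ω 1 4 2) (hA : ContDiffOn ℝ 1 A I)
    (hADV : ∀ t ∈ I, A t ∈ YM.DV1 g Ω T)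
    (φ : ℝ → YM.FormPair g Ω 0 ⊤ 4) (hφ : ContinuousOn φ I)
    (hφDV : ∀ t ∈ I, φ t ∈ YM.DV0 g Ω T)
    (D : ℝ → YM.LpForm g Ω (m + 1) 4) (hD : ContDiffOn ℝ 1 D I)
    (hDE : ∀ t ∈ I, ∀ᵐ x ∂volume.restrict Ω,
      D t x = YM.extendCoeff (ε x) (YM.electricField I A φ t x))
    (ρ : ℝ → YM.LpForm g Ω (m + 2) 1) (hρ : ContDiffOn ℝ 1 ρ I) :
    (∀ (Hhat : ℝ → YM.FormPair g Ω m 2 (4 / 3)) (Dhat : ℝ → YM.FormPair g Ω (m + 1) (4 / 3) 1),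
      (∀ t ∈ I, Hhat t ∈ YM.VhatH g Ω) → (∀ t ∈ I, Dhat t ∈ YM.VhatD g Ω) →
      (YM.SolvesDD T I μinv A φ D ρ Hhat Dhat ↔
        YM.SolvesYM I μinv A φ D ρ ∧
        ∀ t ∈ I, ∀ K ∈ YM.elements T,
          YM.SameTrace (by omega) (YM.DV1 g Ω T) K 2 (4 / 3)
            ((Hhat t).1) (YM.magneticField μinv A t) ∧
          YM.SameTrace (by omega) (YM.DV0 g Ω T) K (4 / 3) 1
            ((Dhat t).1) (D t))) ∧
    (YM.SolvesYM I μinv A φ D ρ →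
      ∃ (Hhat : ℝ → YM.FormPair g Ω m 2 (4 / 3)) (Dhat : ℝ → YM.FormPair g Ω (m + 1) (4 / 3) 1),
        YM.SolvesDD T I μinv A φ D ρ Hhat Dhat) :=
  mainTheorem3_general hΩ.interior_closure T hT μinv hμ.memLp I
    (uniqueDiffOn_convex hI.convex (hI.convex.nontrivial_iff_nonempty_interior.1 hI')) A φ D
    (hD.differentiableOn one_ne_zero) ρ
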